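/- A Carmichael number is a composite integer $n>1$ such that $a^n\equiv a\pmod n$ for every integer $a$. For a positive integer $\nu$ and real $X$, let $C_\nu(X)$ denote the number of Carmichael numbers $n\le X$ such that $\gcd\{p-1 : p \text{ prime},\ p\mid n\}=\nu$. Assume the following form of Heath-Brown's conjecture: there is a real constant $A\ge 2$ such that for all sufficiently large positive integers $l$ and every integer $b$ with $\gcd(b,l)=1$ there is a prime $p\equiv b\pmod l$ with $p<l(\log l)^A$. Then for every even positive integer $\nu$, as $X\to\infty$, $$C_\nu(X)\ \ge\ X^{\,1-(2+o(1))\frac{\log\log\log\log X}{\log\log\log X}},$$ where the $o(1)$ term may depend on $\nu$. That is, for each such $\nu$ there is a function $\varepsilon_\nu$ with $\varepsilon_\nu(X)\to 0$ as $X\to\infty$ such that the inequality with $\varepsilon_\nu(X)$ in place of $o(1)$ holds for all sufficiently large real $X$. -/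

import Mathlib

/-- A Carmichael number: a composite integer `n` with `a ^ n ≡ a (mod n)` for every integer `a`. -/
def IsCarmichael (n : ℕ) : Prop :=
  1 < n ∧ ¬ n.Prime ∧ ∀ a : ℤ, a ^ n ≡ a [ZMOD (n : ℤ)]

/-- The greatest common divisor `K` of the numbers `p - 1`, for `p` in the set of prime factors
of `n`. -/
def gcdPredPrimeFactors (n : ℕ) : ℕ :=
  n.primeFactors.gcd (fun p => p - 1)

/-- The Carmichael numbers `n ≤ X` for which the gcd of the `p - 1`, `p ∣ n` prime, is `ν`. -/
def carmichaelSet (ν : ℕ) (X : ℝ) : Set ℕ :=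
  {n : ℕ | (n : ℝ) ≤ X ∧ IsCarmichael n ∧ gcdPredPrimeFactors n = ν}

/-- The set counted by `carmichaelCount` is finite, so that its `ncard` is its true cardinality. -/
theorem carmichaelSet_finite (ν : ℕ) (X : ℝ) : (carmichaelSet ν X).Finite :=
  (Set.finite_Iic ⌊X⌋₊).subset fun _ hn => Nat.le_floor hn.1

/-- `C_ν(X)`: the number of Carmichael numbers `n ≤ X` with `K = ν`. -/
noncomputable def carmichaelCount (ν : ℕ) (X : ℝ) : ℕ :=
  (carmichaelSet ν X).ncard

/-- Heath-Brown's conjecture on the least prime in an arithmetic progression, for some exponent: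
there is a constant `A ≥ 2` such that for all sufficiently large `l` and every `b` coprime to `l`
there is a prime `p ≡ b (mod l)` with `p < l (log l) ^ A`. -/
def HeathBrownConjecture : Prop :=
  ∃ A : ℝ, 2 ≤ A ∧ ∃ l₀ : ℕ, ∀ l : ℕ, l₀ ≤ l → ∀ b : ℕ, Nat.Coprime b l →
    ∃ p : ℕ, p.Prime ∧ p ≡ b [MOD l] ∧ (p : ℝ) < (l : ℝ) * Real.log (l : ℝ) ^ A

/-! The method is that of Alford, Granville and Pomerance. If distinct primes `p` with `p - 1 ∣ N`
have product `1` modulo `N`, that product is Carmichael by Korselt's criterion. So Carmichael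
numbers arise from zero-sum subfamilies in the unit group of `ZMod N`. When its exponent divides
`M`, any family of more than `M log N` units contains one (`exists_nonempty_sum_eq_zero`), and a
much larger family contains very many (`choose_le_card_sum_eq_zero_mul`).

Heath-Brown's conjecture supplies the primes in two stages. It loses only a power of a logarithm, so
pigeonholing to a common multiplier (`exists_common_multiplier`) is cheap. Stage one gives primes `q
= d * k₁ + 1`, with `d` a product of about `log z` primes up to `z`. All `q - 1` divide `k₁ *
primorial z`, so `N = k * k' * ∏ q` has unit exponent at most `4 ^ z` times a power of `z`. Stage
two gives primes `d * k + 1` and `d' * k' + 1`, where `d` and `d'` are products of `z` of the `q`,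
drawn from disjoint halves, and `gcd k k' = ν`. Predecessors from different families then have gcd
exactly `ν`, so a product using both families has the required gcd.

The constant 2: if `x` bounds these primes, `log x` is about `z a log z` with `a` near `log z`, and
the logarithm of the family size falls short by about `2 z a log log z`. One half is lost to the
density of primes up to `z`, the other to choosing `a` of them. Finally `z` is about `(log log X) /
8`. -/

/-! ### Zero-sum subfamilies in finite abelian groups -/

open Finset in
/-- A greedy choice of values avoided by few characters of a finite abelian group. -/
theorem exists_values_avoided_by_few_addChar {α ι : Type*} [AddCommGroup α] [Fintype α]
    (m : ℕ) (hm : 0 < m) (hexp : ∀ x : α, m • x = 0) (s : Finset ι) (g : ι → α) :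
    ∃ a : ι → ℂ, (∀ i, a i ≠ 0) ∧
      (Nat.card {χ : AddChar α ℂ // ∀ i ∈ s, χ (g i) ≠ a i} : ℝ) ≤
        (1 - 1 / (m : ℝ)) ^ #s * Fintype.card α := by
  classical
  have hm' : (0 : ℝ) < m := by exact_mod_cast hm
  induction s using Finset.induction_on with
  | empty =>
    refine ⟨fun _ => 1, by simp, ?_⟩
    simp [Nat.card_eq_fintype_card, AddChar.card_eq]
  | insert i s his ih =>
    obtain ⟨a, ha, hcard⟩ := ih
    set S : Finset (AddChar α ℂ) := Finset.univ.filter fun χ => ∀ i ∈ s, χ (g i) ≠ a i with hS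
    have hSc : (Nat.card {χ : AddChar α ℂ // ∀ i ∈ s, χ (g i) ≠ a i} : ℝ) = #S := by
      rw [Nat.card_eq_fintype_card, Fintype.card_subtype]
    rw [hSc] at hcard
    have hmaps : ∀ χ ∈ S, χ (g i) ∈ Polynomial.nthRootsFinset m (1 : ℂ) := by
      intro χ _
      rw [Polynomial.mem_nthRootsFinset hm, ← AddChar.map_nsmul_eq_pow, hexp,
        AddChar.map_zero_eq_one]
    have hcardroots : (#(Polynomial.nthRootsFinset m (1 : ℂ)) : ℝ) ≤ m := by
      rw [(Complex.isPrimitiveRoot_exp m hm.ne').card_nthRootsFinset]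
    have hne : (Polynomial.nthRootsFinset m (1 : ℂ)).Nonempty :=
      ⟨1, by rw [Polynomial.mem_nthRootsFinset hm]; simp⟩
    have hb : #(Polynomial.nthRootsFinset m (1 : ℂ)) • ((#S : ℝ) / m) ≤ #S := by
      rw [nsmul_eq_mul]
      calc (#(Polynomial.nthRootsFinset m (1 : ℂ)) : ℝ) * ((#S : ℝ) / m)
          ≤ m * ((#S : ℝ) / m) := by gcongr
        _ = #S := mul_div_cancel₀ _ hm'.ne'
    -- Character values are `m`-th roots of unity, so some root `w` is the value at `g i` of at
    -- least `1 / m` of the surviving characters; taking `a i = w` removes them.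
    obtain ⟨w, hw, hfib⟩ := Finset.exists_le_card_fiber_of_nsmul_le_card_of_maps_to
      (f := fun χ : AddChar α ℂ => χ (g i)) hmaps hne hb
    have hw0 : w ≠ 0 := by
      rintro rfl
      rw [Polynomial.mem_nthRootsFinset hm, zero_pow hm.ne'] at hw
      exact zero_ne_one hw
    refine ⟨Function.update a i w, ?_, ?_⟩
    · intro j
      by_cases hj : j = i
      · subst hj; simpa using hw0
      · simpa [hj] using ha j
    have hset : (Finset.univ.filter fun χ : AddChar α ℂ =>
        ∀ j ∈ insert i s, χ (g j) ≠ Function.update a i w j) =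
        S.filter fun χ => ¬ χ (g i) = w := by
      ext χ
      simp only [hS, Finset.mem_filter, Finset.mem_univ, true_and, Finset.mem_insert,
        forall_eq_or_imp, Function.update_self]
      rw [and_comm]
      refine and_congr_left fun _ => forall₂_congr fun j hj => ?_
      rw [Function.update_of_ne (by rintro rfl; exact his hj)]
    rw [Nat.card_eq_fintype_card, Fintype.card_subtype, hset, Finset.card_insert_of_notMem his]
    have hsplit := Finset.card_filter_add_card_filter_not (s := S) (fun χ => χ (g i) = w)
    have hsplit' : (#(S.filter fun χ => χ (g i) = w) : ℝ) +
      #(S.filter fun χ => ¬ χ (g i) = w) = #S := by exact_mod_cast hsplit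
    have h1m : 0 ≤ 1 - 1 / (m : ℝ) := by
      have : 1 / (m : ℝ) ≤ 1 := by
        rw [div_le_one hm']; exact_mod_cast hm
      linarith
    calc (#(S.filter fun χ => ¬ χ (g i) = w) : ℝ) ≤ (1 - 1 / (m : ℝ)) * #S := by
          have : (1 - 1 / (m : ℝ)) * #S = #S - (#S : ℝ) / m := by ring
          rw [this]; linarith
      _ ≤ (1 - 1 / (m : ℝ)) * ((1 - 1 / (m : ℝ)) ^ #s * Fintype.card α) := by gcongr
      _ = _ := by ring

theorem AddChar.map_finset_sum_eq_prod {α ι M : Type*} [AddCommMonoid α] [CommMonoid M]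
    (χ : AddChar α M) (s : Finset ι) (g : ι → α) : χ (∑ i ∈ s, g i) = ∏ i ∈ s, χ (g i) := by
  classical
  induction s using Finset.induction_on with
  | empty => simp
  | insert i s his ih =>
    rw [Finset.sum_insert his, Finset.prod_insert his, AddChar.map_add_eq_mul, ih]

open Finset in
/-- In a finite abelian group of exponent dividing `m`, every family of more than
`m * log |G|` elements has a nonempty subfamily of sum zero. -/
theorem exists_nonempty_sum_eq_zero {α ι : Type*} [AddCommGroup α] [Fintype α]
    (m : ℕ) (hm : 0 < m) (hexp : ∀ x : α, m • x = 0) (s : Finset ι) (g : ι → α)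
    (hs : m * Real.log (Fintype.card α) < #s) :
    ∃ T ⊆ s, T.Nonempty ∧ ∑ i ∈ T, g i = 0 := by
  classical
  have hm' : (0 : ℝ) < m := by exact_mod_cast hm
  obtain ⟨a, ha, hcard⟩ := exists_values_avoided_by_few_addChar m hm hexp s g
  have hα : (0 : ℝ) < Fintype.card α := by exact_mod_cast Fintype.card_pos
  have hlt : (1 - 1 / (m : ℝ)) ^ #s * Fintype.card α < 1 := by
    have h1m : 0 ≤ 1 - 1 / (m : ℝ) := by
      have : 1 / (m : ℝ) ≤ 1 := by
        rw [div_le_one hm']; exact_mod_cast hm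
      linarith
    calc (1 - 1 / (m : ℝ)) ^ #s * Fintype.card α
        ≤ (Real.exp (-(1 / (m : ℝ)))) ^ #s * Real.exp (Real.log (Fintype.card α)) := by
          rw [Real.exp_log hα]
          gcongr
          linarith [Real.add_one_le_exp (-(1 / (m : ℝ)))]
      _ = Real.exp (Real.log (Fintype.card α) - #s / m) := by
          rw [← Real.exp_nat_mul, ← Real.exp_add]; congr 1; ring
      _ < 1 := by
          rw [Real.exp_lt_one_iff, sub_neg, lt_div_iff₀ hm']
          linarith
  -- Fewer than one character avoids every `a i`, so none does: all Fourier coefficients of the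
  -- group-ring element `∏ (a i - g i)` vanish.
  have hzero : ∀ χ : AddChar α ℂ, ∏ i ∈ s, (-χ (g i) + a i) = 0 := by
    intro χ
    have h0 : Nat.card {χ : AddChar α ℂ // ∀ i ∈ s, χ (g i) ≠ a i} = 0 := by
      have := hcard.trans_lt hlt
      exact Nat.lt_one_iff.mp (by exact_mod_cast this)
    rw [Nat.card_eq_fintype_card, Fintype.card_eq_zero_iff] at h0
    by_contra hne
    refine h0.elim ⟨χ, fun i hi heq => hne ?_⟩
    exact Finset.prod_eq_zero hi (by rw [heq]; ring)
  by_contra! hcon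
  -- Summing over characters extracts `|G|` times the coefficient at zero. Without nonempty zero-sum
  -- subfamilies only the empty subset contributes, giving a nonzero value.
  have hsum : ∑ χ : AddChar α ℂ, ∏ i ∈ s, (-χ (g i) + a i) =
      Fintype.card α * ∏ i ∈ s, a i := by
    simp_rw [Finset.prod_add]
    rw [Finset.sum_comm, Finset.sum_eq_single ∅]
    · simp [AddChar.card_eq]
    · intro T hT hTne
      have hT' := hcon T (Finset.mem_powerset.mp hT) (Finset.nonempty_iff_ne_empty.mpr hTne)
      have : ∀ χ : AddChar α ℂ, (∏ i ∈ T, -χ (g i)) * ∏ i ∈ s \ T, a i =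
          χ (∑ i ∈ T, g i) * ((-1) ^ #T * ∏ i ∈ s \ T, a i) := by
        intro χ
        rw [AddChar.map_finset_sum_eq_prod, Finset.prod_neg]
        ring
      simp_rw [this]
      rw [← Finset.sum_mul, AddChar.sum_apply_eq_ite, if_neg hT', zero_mul]
    · simp
  rw [Finset.sum_eq_zero fun χ _ => hzero χ] at hsum
  have : (Fintype.card α : ℂ) * ∏ i ∈ s, a i ≠ 0 :=
    mul_ne_zero (by exact_mod_cast Fintype.card_ne_zero) (Finset.prod_ne_zero_iff.mpr fun i _ => ha i)
  exact this hsum.symm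

/-! ### Counting zero-sum subsets -/

open Finset in
theorem sum_choose_le_add_one_pow (r n : ℕ) :
    ∑ i ∈ range (n + 1), r.choose i ≤ (r + 1) ^ n := by
  rw [add_pow]
  refine Finset.sum_le_sum fun i hi => ?_
  rw [one_pow, mul_one]
  calc r.choose i ≤ r ^ i := Nat.choose_le_pow _ _
    _ ≤ r ^ i * n.choose i :=
      Nat.le_mul_of_pos_right _ (Nat.choose_pos (Nat.lt_succ_iff.mp (Finset.mem_range.mp hi)))

open Finset in
theorem card_filter_card_le_le {ι : Type*} [DecidableEq ι] (P : Finset ι) (n : ℕ) :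
    #(P.powerset.filter fun J => #J ≤ n) ≤ (#P + 1) ^ n := by
  refine le_trans ?_ (sum_choose_le_add_one_pow #P n)
  have : (P.powerset.filter fun J => #J ≤ n) ⊆ (range (n + 1)).biUnion fun i => P.powersetCard i := by
    intro J hJ
    simp only [mem_filter, mem_powerset] at hJ
    simp only [mem_biUnion, mem_range, mem_powersetCard]
    exact ⟨#J, by omega, hJ.1, rfl⟩
  refine (card_le_card this).trans (card_biUnion_le.trans ?_)
  simp [card_powersetCard]

open Finset in
/-- If every `n`-element subset of `P` has a nonempty zero-sum subset, then `P` has many zero-sum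
subsets whose size lies between `t - n` and `t`. -/
theorem choose_le_card_sum_eq_zero_mul {α ι : Type*} [AddCommMonoid α] [DecidableEq α]
    [DecidableEq ι] (P : Finset ι) (g : ι → α) (n t : ℕ)
    (h : ∀ T ⊆ P, n < #T → ∃ I ⊆ T, I.Nonempty ∧ ∑ i ∈ I, g i = 0) :
    (#P).choose t ≤
      #(P.powerset.filter fun I => t ≤ #I + n ∧ #I ≤ t ∧ ∑ i ∈ I, g i = 0) * (#P + 1) ^ n := by
  -- A zero-sum subset `I` of `T` of maximal size leaves at most `n` elements, as otherwise a
  -- zero-sum part of `T \ I` could be added to it.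
  have key : ∀ T ∈ P.powersetCard t, ∃ I ⊆ T, ∑ i ∈ I, g i = 0 ∧ #(T \ I) ≤ n := by
    intro T hT
    rw [mem_powersetCard] at hT
    obtain ⟨I, hI, hmax⟩ := (T.powerset.filter fun I => ∑ i ∈ I, g i = 0).exists_max_image card
      ⟨∅, by simp⟩
    simp only [mem_filter, mem_powerset] at hI hmax
    refine ⟨I, hI.1, hI.2, ?_⟩
    by_contra! hlt
    obtain ⟨J, hJ, hJne, hJ0⟩ := h (T \ I) (sdiff_subset.trans hT.1) hlt
    have hdisj : Disjoint I J :=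
      disjoint_sdiff.mono_right hJ
    have := hmax (I ∪ J) ⟨union_subset hI.1 (hJ.trans sdiff_subset), by
      rw [sum_union hdisj, hI.2, hJ0, add_zero]⟩
    rw [card_union_of_disjoint hdisj] at this
    have := hJne.card_pos
    omega
  choose! F hFs hF0 hFc using key
  rw [← card_powersetCard]
  refine le_trans ?_ (Nat.mul_le_mul_left _ (card_filter_card_le_le P n))
  rw [← card_product]
  refine card_le_card_of_injOn (fun T => (F T, T \ F T)) ?_ ?_
  · intro T hT
    have hT' := hT
    simp only [mem_coe, mem_powersetCard] at hT'
    have h1 := hFc T hT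
    have h2 := card_sdiff_add_card_eq_card (hFs T hT)
    have h3 := card_le_card (hFs T hT)
    simp only [coe_product, Set.mem_prod, mem_coe, mem_filter, mem_powerset]
    exact ⟨⟨(hFs T hT).trans hT'.1, by omega, by omega, hF0 T hT⟩,
      sdiff_subset.trans hT'.1, h1⟩
  · intro T hT T' hT' heq
    simp only [Prod.mk.injEq] at heq
    rw [← union_sdiff_of_subset (hFs T hT), ← union_sdiff_of_subset (hFs T' hT'), heq.2, heq.1]

/-! ### Korselt's criterion and primes with a common multiplier -/

/-- A product of at least two distinct primes `p` with `p - 1 ∣ n - 1` is a Carmichael number. -/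
theorem isCarmichael_prod (S : Finset ℕ) (hS : ∀ p ∈ S, p.Prime) (hcard : 1 < S.card)
    (hdvd : ∀ p ∈ S, ∏ q ∈ S, q ≡ 1 [MOD (p - 1)]) : IsCarmichael (∏ q ∈ S, q) := by
  have hpf : (∏ q ∈ S, q).primeFactors = S := Nat.primeFactors_prod hS
  have hpos : 0 < ∏ q ∈ S, q := Finset.prod_pos fun p hp => (hS p hp).pos
  refine ⟨?_, ?_, ?_⟩
  · obtain ⟨p, hp⟩ := Finset.card_pos.mp (by omega : 0 < S.card)
    exact (hS p hp).one_lt.trans_le (Nat.le_of_dvd hpos (Finset.dvd_prod_of_mem _ hp))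
  · intro hprime
    rw [hprime.primeFactors] at hpf
    rw [← hpf] at hcard
    simp at hcard
  · intro a
    symm
    rw [Int.modEq_iff_dvd, Nat.cast_prod]
    refine Finset.prod_dvd_of_coprime (fun p hp q hq hpq => ?_) fun p hp => ?_
    · exact Nat.isCoprime_iff_coprime.mpr ((Nat.coprime_primes (hS p hp) (hS q hq)).mpr hpq)
    · have := Fact.mk (hS p hp)
      rw [← Int.modEq_iff_dvd, ← ZMod.intCast_eq_intCast_iff]
      push_cast
      by_cases ha : (a : ZMod p) = 0
      · rw [ha, zero_pow (by exact_mod_cast hpos.ne')]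
      · obtain ⟨c, hc⟩ := (Nat.modEq_iff_dvd' hpos).mp (hdvd p hp).symm
        have hn : ∏ q ∈ S, q = (p - 1) * c + 1 := by omega
        rw [hn, pow_succ, pow_mul, ZMod.pow_card_sub_one_eq_one ha, one_pow, one_mul]

/-- For even `e` there is `c` such that `c` is prime to `m` and `1 + e * c` is prime to `e * m`. -/
theorem exists_coprime_one_add_mul (e m : ℕ) (he : Even e) (hm : 0 < m) :
    ∃ c, Nat.Coprime c m ∧ Nat.Coprime (1 + e * c) (e * m) := by
  classical
  -- Modulo each prime `r ∣ m` the choice `c = 1` works unless `r ∣ 1 + e`. Then `r` is odd because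
  -- `e` is even, and `c = 2` works.
  obtain ⟨c, hc⟩ := Nat.chineseRemainderOfFinset (fun r => if r ∣ 1 + e then 2 else 1) (fun r => r)
    m.primeFactors (fun r hr => (Nat.prime_of_mem_primeFactors hr).ne_zero)
    (fun r hr s hs hrs => (Nat.coprime_primes (Nat.prime_of_mem_primeFactors hr)
      (Nat.prime_of_mem_primeFactors hs)).mpr hrs)
  have key : ∀ r, r.Prime → r ∣ m → ¬ r ∣ c ∧ ¬ r ∣ 1 + e * c := by
    intro r hr hrm
    have h := hc r (Nat.mem_primeFactors.mpr ⟨hr, hrm, hm.ne'⟩)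
    split_ifs at h with h1
    · have hr2 : r ≠ 2 := by
        rintro rfl
        have := he.two_dvd
        omega
      refine ⟨fun hrc => hr2 ?_, fun hrc => hr.one_lt.ne' ?_⟩
      · exact (Nat.prime_dvd_prime_iff_eq hr Nat.prime_two).mp ((h.dvd_iff dvd_rfl).mp hrc)
      · have h2 : 1 + e * c ≡ 1 + e * 2 [MOD r] := (h.mul_left e).add_left 1
        have h3 : r ∣ 1 + e * 2 := (h2.dvd_iff dvd_rfl).mp hrc
        have h4 : r ∣ e := by
          have := Nat.dvd_sub h3 h1
          rwa [show 1 + e * 2 - (1 + e) = e by omega] at this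
        exact Nat.dvd_one.mp ((Nat.dvd_add_left h4).mp h1)
    · refine ⟨fun hrc => hr.one_lt.ne' ?_, fun hrc => h1 ?_⟩
      · exact Nat.dvd_one.mp ((h.dvd_iff dvd_rfl).mp hrc)
      · have h2 : 1 + e * c ≡ 1 + e * 1 [MOD r] := (h.mul_left e).add_left 1
        simpa using (h2.dvd_iff dvd_rfl).mp hrc
  refine ⟨c, ?_, Nat.Coprime.mul_right ?_ ?_⟩
  · exact Nat.coprime_of_dvd fun r hr h1 h2 => (key r hr h2).1 h1
  · simp
  · exact Nat.coprime_of_dvd fun r hr h1 h2 => (key r hr h2).2 h1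

/-- Under Heath-Brown's conjecture, many elements `d` of a finite set share a multiplier `k`
with `d * k + 1` prime. -/
theorem exists_common_multiplier {A : ℝ} (hA : 0 ≤ A) {l₀ : ℕ}
    (hHB : ∀ l : ℕ, l₀ ≤ l → ∀ b : ℕ, Nat.Coprime b l →
      ∃ p : ℕ, p.Prime ∧ p ≡ b [MOD l] ∧ (p : ℝ) < (l : ℝ) * Real.log (l : ℝ) ^ A)
    (ν m : ℕ) (hν : 0 < ν) (hν2 : Even ν) (hm : 0 < m) (D : Finset ℕ) (hD : D.Nonempty) (Y B : ℕ)
    (hDl : ∀ d ∈ D, l₀ ≤ d) (hDpos : ∀ d ∈ D, 0 < d) (hDY : ∀ d ∈ D, d ≤ Y)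
    (hB : (ν * m : ℝ) * Real.log (ν * m * Y) ^ A ≤ B) :
    ∃ k, 0 < k ∧ k ≤ B ∧ ν ∣ k ∧ Nat.Coprime (k / ν) m ∧
      D.card ≤ B * (D.filter fun d => (d * k + 1).Prime).card := by
  have key : ∀ d ∈ D, ∃ k, 0 < k ∧ k ≤ B ∧ ν ∣ k ∧ Nat.Coprime (k / ν) m ∧ (d * k + 1).Prime := by
    intro d hd
    have hd0 := hDpos d hd
    -- The residue `1 + ν * d * c` modulo `ν * d * m` forces `p = 1 + ν * d * j` with `j ≡ c` modulo
    -- `m`, so the multiplier `ν * j` has cofactor `j` prime to `m`.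
    obtain ⟨c, hc, hc'⟩ := exists_coprime_one_add_mul (ν * d) m (hν2.mul_right d) hm
    obtain ⟨p, hp, hpb, hlt⟩ := hHB (ν * d * m) ((hDl d hd).trans (by
      calc d = 1 * d * 1 := by ring
        _ ≤ ν * d * m := by gcongr <;> omega)) _ hc'
    have hmod : p ≡ 1 [MOD ν * d] := by
      have h1 : p ≡ 1 + ν * d * c [MOD ν * d] := hpb.of_mul_right m
      exact h1.trans (by simp [Nat.ModEq])
    obtain ⟨j, hj⟩ := (Nat.modEq_iff_dvd' hp.one_lt.le).mp hmod.symm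
    have hpj : p = 1 + ν * d * j := by have := hp.one_lt; omega
    have hj0 : 0 < j := by
      rcases Nat.eq_zero_or_pos j with rfl | h
      · exact absurd hp.one_lt (by omega)
      · exact h
    have hjc : j ≡ c [MOD m] := by
      rw [hpj] at hpb
      have h1 := Nat.ModEq.add_left_cancel' 1 hpb
      exact Nat.ModEq.mul_left_cancel' (by positivity) h1
    refine ⟨ν * j, by positivity, ?_, dvd_mul_right _ _, ?_, ?_⟩
    · have hlog : Real.log ((ν * d * m : ℕ) : ℝ) ^ A ≤ Real.log (ν * m * Y) ^ A := by
        have h1 : (1 : ℝ) ≤ ((ν * d * m : ℕ) : ℝ) := by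
          exact_mod_cast Nat.succ_le_of_lt (by positivity)
        refine Real.rpow_le_rpow (Real.log_nonneg h1) (Real.log_le_log (by linarith) ?_) hA
        push_cast
        have : (d : ℝ) ≤ Y := by exact_mod_cast hDY d hd
        calc (ν * d * m : ℝ) ≤ ν * Y * m := by gcongr
          _ = ν * m * Y := by ring
      have h2 : (d : ℝ) * (ν * j) < d * B := by
        calc (d : ℝ) * (ν * j) = ((ν * d * j : ℕ) : ℝ) := by push_cast; ring
          _ < p := by exact_mod_cast (by omega)
          _ < ((ν * d * m : ℕ) : ℝ) * Real.log ((ν * d * m : ℕ) : ℝ) ^ A := hlt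
          _ ≤ ((ν * d * m : ℕ) : ℝ) * Real.log (ν * m * Y) ^ A := by gcongr
          _ = d * ((ν * m) * Real.log (ν * m * Y) ^ A) := by push_cast; ring
          _ ≤ d * B := by gcongr
      have h3 : d * (ν * j) < d * B := by exact_mod_cast h2
      exact (lt_of_mul_lt_mul_left h3 (Nat.zero_le _)).le
    · rw [Nat.mul_div_cancel_left _ hν]
      exact (hjc.gcd_eq).trans hc
    · have : d * (ν * j) + 1 = p := by rw [hpj]; ring
      rwa [this]
  choose! f hf0 hfB hfν hfc hfp using key
  have hBpos : 0 < B := by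
    obtain ⟨d, hd⟩ := hD
    exact (hf0 d hd).trans_le (hfB d hd)
  have hmaps : ∀ d ∈ D, f d ∈ Finset.Icc 1 B := fun d hd =>
    Finset.mem_Icc.mpr ⟨hf0 d hd, hfB d hd⟩
  obtain ⟨k, hk, hfib⟩ := Finset.exists_le_card_fiber_of_nsmul_le_card_of_maps_to
    (b := (D.card : ℝ) / B) hmaps ⟨1, Finset.mem_Icc.mpr ⟨le_rfl, hBpos⟩⟩ (by
      rw [nsmul_eq_mul, Nat.card_Icc, Nat.add_sub_cancel]
      exact (mul_div_cancel₀ _ (by exact_mod_cast hBpos.ne')).le)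
  have hBr : (0 : ℝ) < B := by exact_mod_cast hBpos
  rw [div_le_iff₀ hBr] at hfib
  have hfib' : D.card ≤ (D.filter fun d => f d = k).card * B := by exact_mod_cast hfib
  have hne : (D.filter fun d => f d = k).Nonempty := by
    rw [← Finset.card_pos]
    by_contra h0
    have := hD.card_pos
    rw [Nat.eq_zero_of_not_pos h0] at hfib'
    omega
  obtain ⟨d, hd⟩ := hne
  rw [Finset.mem_filter] at hd
  obtain ⟨hd, rfl⟩ := hd
  refine ⟨f d, hf0 d hd, hfB d hd, hfν d hd, hfc d hd, hfib'.trans ?_⟩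
  rw [mul_comm]
  refine Nat.mul_le_mul_left _ (Finset.card_le_card ?_)
  intro d' hd'
  rw [Finset.mem_filter] at hd' ⊢
  exact ⟨hd'.1, by rw [← hd'.2]; exact hfp d' hd'.1⟩

theorem card_image_prod_powersetCard (Q : Finset ℕ) (hQ : ∀ q ∈ Q, q.Prime) (b : ℕ) :
    ((Q.powersetCard b).image fun S => ∏ q ∈ S, q).card = Q.card.choose b := by
  rw [Finset.card_image_of_injOn, Finset.card_powersetCard]
  intro S hS T hT h
  simp only [Finset.mem_coe, Finset.mem_powersetCard] at hS hT
  rw [← Nat.primeFactors_prod fun q hq => hQ q (hS.1 hq),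
    ← Nat.primeFactors_prod fun q hq => hQ q (hT.1 hq)]
  exact congrArg _ h

/-- Under Heath-Brown's conjecture, there are many primes `d * k + 1` with a common `k`, where `d` runs
over products of `b` primes of a given finite set. -/
theorem exists_many_primes {A : ℝ} (hA : 0 ≤ A) {l₀ : ℕ}
    (hHB : ∀ l : ℕ, l₀ ≤ l → ∀ b : ℕ, Nat.Coprime b l →
      ∃ p : ℕ, p.Prime ∧ p ≡ b [MOD l] ∧ (p : ℝ) < (l : ℝ) * Real.log (l : ℝ) ^ A)
    (ν m : ℕ) (hν : 0 < ν) (hν2 : Even ν) (hm : 0 < m) (Q : Finset ℕ) (hQ : ∀ q ∈ Q, q.Prime)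
    (y b K : ℕ) (hQy : ∀ q ∈ Q, q ≤ y) (hb : b ≤ Q.card) (hl : l₀ ≤ 2 ^ b)
    (hK : (ν * m : ℝ) * Real.log (ν * m * (y ^ b : ℕ)) ^ A ≤ K) :
    ∃ (k : ℕ) (P : Finset ℕ), 0 < k ∧ k ≤ K ∧ ν ∣ k ∧ Nat.Coprime (k / ν) m ∧
      (∀ p ∈ P, p.Prime ∧ ∃ d, d ∣ ∏ q ∈ Q, q ∧ 2 ^ b ≤ d ∧ d ≤ y ^ b ∧ p = d * k + 1) ∧
      Q.card.choose b ≤ K * P.card := by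
  set D := (Q.powersetCard b).image fun S => ∏ q ∈ S, q with hDdef
  have hDprop : ∀ d ∈ D, d ∣ ∏ q ∈ Q, q ∧ 2 ^ b ≤ d ∧ d ≤ y ^ b := by
    intro d hd
    simp only [hDdef, Finset.mem_image, Finset.mem_powersetCard] at hd
    obtain ⟨S, ⟨hSQ, hSb⟩, rfl⟩ := hd
    refine ⟨Finset.prod_dvd_prod_of_subset _ _ _ hSQ, ?_, ?_⟩
    · rw [← hSb]
      exact Finset.pow_card_le_prod _ _ _ fun q hq => (hQ q (hSQ hq)).two_le
    · rw [← hSb]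
      exact Finset.prod_le_pow_card _ _ _ fun q hq => hQy q (hSQ hq)
  have hDne : D.Nonempty := by
    rw [← Finset.card_pos, hDdef, card_image_prod_powersetCard Q hQ]
    exact Nat.choose_pos hb
  obtain ⟨k, hk0, hkK, hνk, hkm, hcard⟩ := exists_common_multiplier hA hHB ν m hν hν2 hm D hDne
    (y ^ b) K (fun d hd => hl.trans (hDprop d hd).2.1)
    (fun d hd => (by positivity : 0 < 2 ^ b).trans_le (hDprop d hd).2.1)
    (fun d hd => (hDprop d hd).2.2) hK
  refine ⟨k, (D.filter fun d => (d * k + 1).Prime).image fun d => d * k + 1, hk0, hkK, hνk, hkm,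
    ?_, ?_⟩
  · intro p hp
    simp only [Finset.mem_image, Finset.mem_filter] at hp
    obtain ⟨d, ⟨hd, hdp⟩, rfl⟩ := hp
    exact ⟨hdp, d, (hDprop d hd).1, (hDprop d hd).2.1, (hDprop d hd).2.2, rfl⟩
  · rw [Finset.card_image_of_injective, ← card_image_prod_powersetCard Q hQ]
    · exact hcard
    · intro d d' h
      simpa [hk0.ne'] using h

/-! ### The two families of primes -/

/-- Two disjoint families of primes, whose predecessors divide a modulus `N` with a small exponent
`M` of its unit group, and such that `p - 1` and `p' - 1` have gcd `ν` for `p`, `p'` in different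
families. -/
theorem exists_prime_families {A : ℝ} (hA : 0 ≤ A) {l₀ : ℕ}
    (hHB : ∀ l : ℕ, l₀ ≤ l → ∀ b : ℕ, Nat.Coprime b l →
      ∃ p : ℕ, p.Prime ∧ p ≡ b [MOD l] ∧ (p : ℝ) < (l : ℝ) * Real.log (l : ℝ) ^ A)
    (ν : ℕ) (hν : 0 < ν) (hν2 : Even ν) (z a b K₁ K₀ K y n : ℕ)
    (hK₁ : 2 * Real.log (2 * (z ^ a : ℕ)) ^ A ≤ K₁) (haz : a ≤ Nat.primeCounting z)
    (hla : l₀ ≤ 2 ^ a) (hlb : l₀ ≤ 2 ^ b) (hy : z ^ a * K₁ + 1 ≤ y)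
    (hK₀ : ν * Real.log (ν * (y ^ b : ℕ)) ^ A ≤ K₀)
    (hK : (ν * K₀) * Real.log (ν * K₀ * (y ^ b : ℕ)) ^ A ≤ K) (hK₀K : K₀ ≤ K)
    (hn : K₁ * (2 * n + K) ≤ (Nat.primeCounting z).choose a) (hbn : b ≤ n) (hb : 0 < b)
    (hyb : y < 2 ^ b) (hνb : ν < 2 ^ b) :
    ∃ (N M : ℕ) (P P' : Finset ℕ), 0 < N ∧ 0 < M ∧ N ≤ K * K * y ^ (2 * n) ∧
      M ≤ K * K * (K₁ * 4 ^ z) ∧ (∀ c, Nat.Coprime c N → c ^ M ≡ 1 [MOD N]) ∧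
      (∀ p ∈ P ∪ P', p.Prime ∧ p ≤ y ^ b * K + 1 ∧ Nat.Coprime p N ∧ p - 1 ∣ N) ∧
      (∀ p ∈ P, ∀ p' ∈ P', Nat.gcd (p - 1) (p' - 1) = ν) ∧ Disjoint P P' ∧
      n.choose b ≤ K * P.card ∧ n.choose b ≤ K * P'.card := by
  classical
  obtain ⟨k₁, Q, hk₁, hk₁K, -, -, hQ, hQcard⟩ := exists_many_primes hA hHB 2 1 two_pos even_two
    one_pos (Nat.primesLE z) (fun q hq => Nat.prime_of_mem_primesLE hq) z a K₁
    (fun q hq => Nat.le_of_mem_primesLE hq) (by simpa using haz) hla (by simpa using hK₁)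
  have hQy : ∀ q ∈ Q, q ≤ y := by
    intro q hq
    obtain ⟨-, d, -, -, hd, rfl⟩ := hQ q hq
    refine le_trans ?_ hy
    gcongr
  have hprim : ∏ q ∈ Nat.primesLE z, q = primorial z := rfl
  have hQdvd : ∀ q ∈ Q, q - 1 ∣ k₁ * primorial z := by
    intro q hq
    obtain ⟨-, d, hd, -, -, rfl⟩ := hQ q hq
    rw [hprim] at hd
    rw [Nat.add_sub_cancel, mul_comm]
    exact mul_dvd_mul_left _ hd
  have hK₁pos : 0 < K₁ := hk₁.trans_le hk₁K
  -- Primes above `K` are coprime to both later multipliers; at most `K` elements are discarded.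
  set R := Q.filter fun q => K < q with hR
  have hRcard : 2 * n ≤ R.card := by
    have h1 : R.card + (Q.filter fun q => ¬ K < q).card = Q.card :=
      Finset.card_filter_add_card_filter_not _
    have h2 : (Q.filter fun q => ¬ K < q).card ≤ K := by
      calc (Q.filter fun q => ¬ K < q).card ≤ (Finset.Icc 1 K).card := by
            refine Finset.card_le_card fun q hq => ?_
            rw [Finset.mem_filter] at hq
            exact Finset.mem_Icc.mpr ⟨(hQ q hq.1).1.pos, not_lt.mp hq.2⟩
        _ = K := by simp
    have h3 : K₁ * (2 * n + K) ≤ K₁ * Q.card := by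
      refine hn.trans ?_
      simpa using hQcard
    have := Nat.le_of_mul_le_mul_left h3 hK₁pos
    omega
  obtain ⟨Q₀, hQ₀R, hQ₀card⟩ := Finset.exists_subset_card_eq hRcard
  obtain ⟨Q₁, hQ₁, hQ₁card⟩ := Finset.exists_subset_card_eq (s := Q₀) (n := n) (by omega)
  set Q₂ := Q₀ \ Q₁ with hQ₂
  have hQ₂card : Q₂.card = n := by
    rw [hQ₂, Finset.card_sdiff_of_subset hQ₁]; omega
  have hQ₂Q₀ : Q₂ ⊆ Q₀ := Finset.sdiff_subset
  have hQ₀prop : ∀ q ∈ Q₀, q.Prime ∧ q ≤ y ∧ K < q ∧ q - 1 ∣ k₁ * primorial z := by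
    intro q hq
    have := Finset.mem_filter.mp (hQ₀R hq)
    exact ⟨(hQ q this.1).1, hQy q this.1, this.2, hQdvd q this.1⟩
  obtain ⟨k, P, hk, hkK₀, hνk, -, hP, hPcard⟩ := exists_many_primes hA hHB ν 1 hν hν2 one_pos Q₁
    (fun q hq => (hQ₀prop q (hQ₁ hq)).1) y b K₀ (fun q hq => (hQ₀prop q (hQ₁ hq)).2.1)
    (by omega) hlb (by simpa using hK₀)
  have hK0' : (ν * k : ℝ) * Real.log (ν * k * (y ^ b : ℕ)) ^ A ≤ K := by
    refine le_trans ?_ hK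
    have hy1 : (1 : ℝ) ≤ (y ^ b : ℕ) := by
      exact_mod_cast Nat.one_le_pow _ _ (by omega)
    have hk1 : (1 : ℝ) ≤ k := by exact_mod_cast hk
    have hν1 : (1 : ℝ) ≤ ν := by exact_mod_cast hν
    have hkK : (k : ℝ) ≤ K₀ := by exact_mod_cast hkK₀
    have h1 : (1 : ℝ) ≤ ν * k * (y ^ b : ℕ) := by
      calc (1 : ℝ) = 1 * 1 * 1 := by ring
        _ ≤ _ := by gcongr
    have h2 : 0 ≤ Real.log (ν * k * (y ^ b : ℕ)) := Real.log_nonneg h1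
    gcongr
  -- Taking `m = k` makes `k' / ν` prime to `k`, whence `gcd k k' = ν`.
  obtain ⟨k', P', hk', hkK', hνk', hcop, hP', hPcard'⟩ := exists_many_primes hA hHB ν k hν hν2 hk Q₂
    (fun q hq => (hQ₀prop q (hQ₂Q₀ hq)).1) y b K (fun q hq => (hQ₀prop q (hQ₂Q₀ hq)).2.1)
    (by omega) hlb hK0'
  have hkK : k ≤ K := hkK₀.trans hK₀K
  have hsmall : ∀ q ∈ Q₀, ∀ j, 0 < j → j ≤ K → Nat.Coprime q j := by
    intro q hq j hj hjK
    have := hQ₀prop q hq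
    exact Nat.coprime_of_lt_prime hj.ne' (hjK.trans_lt this.2.2.1) this.1
  have hsplit : ∏ q ∈ Q₀, q = (∏ q ∈ Q₂, q) * ∏ q ∈ Q₁, q := (Finset.prod_sdiff hQ₁).symm
  have hgcdk : Nat.gcd k k' = ν := by
    obtain ⟨e, rfl⟩ := hνk
    obtain ⟨e', rfl⟩ := hνk'
    rw [Nat.mul_div_cancel_left _ hν] at hcop
    rw [Nat.gcd_mul_left, Nat.Coprime.coprime_mul_left_right hcop |>.symm, mul_one]
  have hyK : K < y := by
    have : Q₀.Nonempty := by rw [← Finset.card_pos]; omega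
    obtain ⟨q, hq⟩ := this
    exact (hQ₀prop q hq).2.2.1.trans_le (hQ₀prop q hq).2.1
  have hprodpos : 0 < ∏ q ∈ Q₀, q := Finset.prod_pos fun q hq => (hQ₀prop q hq).1.pos
  have hgcd : ∀ p ∈ P, ∀ p' ∈ P', Nat.gcd (p - 1) (p' - 1) = ν := by
    intro p hp p' hp'
    obtain ⟨-, d, hd, -, -, rfl⟩ := hP p hp
    obtain ⟨-, d', hd', -, -, rfl⟩ := hP' p' hp'
    have hdd' : Nat.Coprime d d' := by
      refine Nat.Coprime.of_dvd hd hd' ?_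
      refine Nat.Coprime.prod_left fun q hq => Nat.Coprime.prod_right fun q' hq' => ?_
      refine (Nat.coprime_primes (hQ₀prop q (hQ₁ hq)).1 (hQ₀prop q' (hQ₂Q₀ hq')).1).mpr ?_
      rintro rfl
      exact (Finset.mem_sdiff.mp hq').2 hq
    have hdk' : Nat.Coprime d k' := Nat.Coprime.of_dvd_left hd
      (Nat.Coprime.prod_left fun q hq => hsmall q (hQ₁ hq) k' hk' hkK')
    have hd'k : Nat.Coprime d' k := Nat.Coprime.of_dvd_left hd'
      (Nat.Coprime.prod_left fun q hq => hsmall q (hQ₂Q₀ hq) k hk hkK)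
    rw [Nat.add_sub_cancel, Nat.add_sub_cancel, (hdd'.mul_right hdk').gcd_mul_left_cancel,
      hd'k.gcd_mul_left_cancel_right, hgcdk]
  -- Every prime factor of the modulus is at most `y < 2 ^ b`, whereas the new primes exceed `2 ^
  -- b`.
  have hcopN : ∀ p, p.Prime → 2 ^ b < p → Nat.Coprime p (k * k' * ∏ q ∈ Q₀, q) := by
    intro p hp hpb
    refine Nat.Coprime.mul_right (Nat.Coprime.mul_right ?_ ?_) (Nat.Coprime.prod_right ?_)
    · exact Nat.coprime_of_lt_prime hk.ne' (by omega) hp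
    · exact Nat.coprime_of_lt_prime hk'.ne' (by omega) hp
    · intro q hq
      have := hQ₀prop q hq
      exact (Nat.coprime_primes hp this.1).mpr (by omega)
  have hpb : ∀ d j, 2 ^ b ≤ d → 0 < j → 2 ^ b < d * j + 1 := by
    intro d j hd hj
    have := Nat.le_mul_of_pos_right d hj
    omega
  -- The exponent is a multiple of `φ(k k')` and of every `q - 1`, hence works modulo each coprime
  -- factor of the modulus.
  refine ⟨k * k' * ∏ q ∈ Q₀, q, Nat.totient (k * k') * (k₁ * primorial z), P, P', by positivity,
    ?_, ?_, ?_, ?_, ?_, hgcd, ?_, ?_, ?_⟩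
  · have := Nat.totient_pos.mpr (Nat.mul_pos hk hk')
    have := primorial_pos z
    positivity
  · rw [← hQ₀card]
    gcongr
    exact Finset.prod_le_pow_card _ _ _ fun q hq => (hQ₀prop q hq).2.1
  · gcongr
    · exact (Nat.totient_le _).trans (Nat.mul_le_mul hkK hkK')
    · exact primorial_le_four_pow z
  · intro c hc
    have hc1 : Nat.Coprime c (k * k') := hc.coprime_mul_right_right
    have hc2 : Nat.Coprime c (∏ q ∈ Q₀, q) := hc.coprime_mul_left_right
    rw [← Nat.modEq_and_modEq_iff_modEq_mul]
    · constructor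
      · rw [pow_mul]
        simpa using (Nat.ModEq.pow_totient hc1).pow (k₁ * primorial z)
      · refine (Nat.modEq_iff_dvd).mpr ?_
        rw [Nat.cast_prod]
        refine Finset.prod_dvd_of_coprime (fun p hp q hq hpq => ?_) fun q hq => ?_
        · exact Nat.isCoprime_iff_coprime.mpr
            ((Nat.coprime_primes (hQ₀prop p hp).1 (hQ₀prop q hq).1).mpr hpq)
        · refine (Nat.modEq_iff_dvd).mp ?_
          have hqp := hQ₀prop q hq
          have hcq : Nat.Coprime c q := Nat.Coprime.of_dvd_right (Finset.dvd_prod_of_mem _ hq) hc2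
          have h1 : c ^ (q - 1) ≡ 1 [MOD q] := by
            rw [← Nat.totient_prime hqp.1]
            exact Nat.ModEq.pow_totient hcq
          obtain ⟨e, he⟩ := hqp.2.2.2.mul_left (Nat.totient (k * k'))
          rw [he, pow_mul]
          simpa using h1.pow e
    · exact Nat.Coprime.mul_left
        (Nat.Coprime.prod_right fun q hq => (hsmall q hq k hk hkK).symm)
        (Nat.Coprime.prod_right fun q hq => (hsmall q hq k' hk' hkK').symm)
  · intro p hp
    rcases Finset.mem_union.mp hp with hp | hp
    · obtain ⟨hpp, d, hd, hd2, hdy, rfl⟩ := hP p hp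
      refine ⟨hpp, by gcongr, hcopN _ hpp (hpb d k hd2 hk), ?_⟩
      rw [Nat.add_sub_cancel, hsplit]
      obtain ⟨e, he⟩ := hd
      rw [he]
      exact ⟨k' * e * ∏ q ∈ Q₂, q, by ring⟩
    · obtain ⟨hpp, d, hd, hd2, hdy, rfl⟩ := hP' p hp
      refine ⟨hpp, by gcongr, hcopN _ hpp (hpb d k' hd2 hk'), ?_⟩
      rw [Nat.add_sub_cancel, hsplit]
      obtain ⟨e, he⟩ := hd
      rw [he]
      exact ⟨k * e * ∏ q ∈ Q₁, q, by ring⟩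
  -- A common prime `p` would satisfy `p - 1 = ν`, but `p - 1 ≥ 2 ^ b > ν`.
  · rw [Finset.disjoint_left]
    intro p hp hp'
    have h1 := hgcd p hp p hp'
    rw [Nat.gcd_self] at h1
    obtain ⟨-, d, -, hd2, -, rfl⟩ := hP p hp
    have := hpb d k hd2 hk
    omega
  · rw [← hQ₁card]
    exact hPcard.trans (Nat.mul_le_mul_right _ hK₀K)
  · rw [← hQ₂card]
    exact hPcard'

/-! ### From prime families to Carmichael numbers -/

open Finset in
/-- The families of `exists_prime_families` yield many Carmichael numbers. -/
theorem choose_le_carmichaelCount_mul (ν N M x n₀ t : ℕ) (X : ℝ) (P P' : Finset ℕ)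
    (hN : 0 < N) (hM : 0 < M) (hNM : ∀ c, Nat.Coprime c N → c ^ M ≡ 1 [MOD N])
    (hP : ∀ p ∈ P ∪ P', p.Prime ∧ p ≤ x ∧ Nat.Coprime p N ∧ p - 1 ∣ N)
    (hgcd : ∀ p ∈ P, ∀ p' ∈ P', Nat.gcd (p - 1) (p' - 1) = ν) (hdisj : Disjoint P P')
    (hn₀ : M * Real.log N < n₀) (hn₀P : n₀ ≤ #P') (ht : n₀ < t) (hx : 0 < x)
    (hX : ((x ^ (t + n₀) : ℕ) : ℝ) ≤ X) :
    (#P).choose t ≤ carmichaelCount ν X * (#P + 1) ^ n₀ := by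
  classical
  have : NeZero N := ⟨hN.ne'⟩
  -- The default value `0` is never used on `P ∪ P'`, whose elements are coprime to `N`.
  set g : ℕ → Additive (ZMod N)ˣ := fun p =>
    if h : Nat.Coprime p N then Additive.ofMul (ZMod.unitOfCoprime p h) else 0 with hg
  have hexp : ∀ w : Additive (ZMod N)ˣ, M • w = 0 := by
    intro w
    have h1 := hNM _ (ZMod.val_coe_unit_coprime w.toMul)
    rw [← ZMod.natCast_eq_natCast_iff] at h1
    have h2 : w.toMul ^ M = 1 := by
      ext
      simpa using h1
    exact h2
  have hcardlog : ∀ s : Finset ℕ, n₀ ≤ #s →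
      M * Real.log (Fintype.card (Additive (ZMod N)ˣ)) < #s := by
    intro s hs
    have h1 : Fintype.card (Additive (ZMod N)ˣ) ≤ N := by
      rw [Fintype.card_additive, ZMod.card_units_eq_totient]
      exact Nat.totient_le N
    have h2 : Real.log (Fintype.card (Additive (ZMod N)ˣ)) ≤ Real.log N :=
      Real.log_le_log (by exact_mod_cast Fintype.card_pos) (by exact_mod_cast h1)
    calc M * Real.log (Fintype.card (Additive (ZMod N)ˣ)) ≤ M * Real.log N := by gcongr
      _ < n₀ := hn₀
      _ ≤ #s := by exact_mod_cast hs
  have hprod : ∀ I ⊆ P ∪ P', ∑ p ∈ I, g p = 0 → ∏ p ∈ I, p ≡ 1 [MOD N] := by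
    intro I hI h0
    have h1 : ∀ p ∈ I, (((g p).toMul : (ZMod N)ˣ) : ZMod N) = p := by
      intro p hp
      rw [hg]
      simp only [dif_pos (hP p (hI hp)).2.2.1, toMul_ofMul, ZMod.coe_unitOfCoprime]
    have h2 : ∏ p ∈ I, (g p).toMul = 1 := by
      have := congrArg Additive.toMul h0
      simpa using this
    rw [← ZMod.natCast_eq_natCast_iff, Nat.cast_prod, ← Finset.prod_congr rfl h1, ← Units.coe_prod, h2]
    simp
  obtain ⟨P₀, hP₀, hP₀card⟩ := exists_subset_card_eq hn₀P
  -- This single `T` from the second family is attached to every zero-sum `I ⊆ P`; it fixes the gcd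
  -- and costs at most `n₀` extra prime factors.
  obtain ⟨T, hT, hTne, hT0⟩ := exists_nonempty_sum_eq_zero M hM hexp P₀ g (hcardlog P₀ hP₀card.ge)
  have hTP' : T ⊆ P' := hT.trans hP₀
  have hTcard : #T ≤ n₀ := (card_le_card hT).trans hP₀card.le
  refine (choose_le_card_sum_eq_zero_mul P g n₀ t fun S _ hS =>
    exists_nonempty_sum_eq_zero M hM hexp S g (hcardlog S hS.le)).trans ?_
  refine Nat.mul_le_mul_right _ ?_
  rw [carmichaelCount, ← Set.ncard_coe_finset]
  have hunion : ∀ I ⊆ P, ∀ p ∈ I ∪ T, p.Prime := fun I hI p hp =>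
    (hP p (union_subset_union hI hTP' hp)).1
  refine Set.ncard_le_ncard_of_injOn (fun I => ∏ p ∈ I ∪ T, p) ?_ ?_ (carmichaelSet_finite ν X)
  · intro I hI
    simp only [coe_filter, mem_powerset, Set.mem_ofPred_eq] at hI
    obtain ⟨hIP, hIn, hIt, hI0⟩ := hI
    have hIT : Disjoint I T := disjoint_of_subset_left hIP (disjoint_of_subset_right hTP' hdisj)
    have hIne : I.Nonempty := by rw [← card_pos]; omega
    have hsub : I ∪ T ⊆ P ∪ P' := union_subset_union hIP hTP'
    have hmod : ∏ p ∈ I ∪ T, p ≡ 1 [MOD N] := hprod _ hsub (by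
      rw [sum_union hIT, hI0, hT0, add_zero])
    refine ⟨le_trans ?_ hX, isCarmichael_prod _ (hunion I hIP) ?_ ?_, ?_⟩
    · have h1 : ∏ p ∈ I ∪ T, p ≤ x ^ #(I ∪ T) :=
        prod_le_pow_card _ _ _ fun p hp => (hP p (hsub hp)).2.1
      have h2 : x ^ #(I ∪ T) ≤ x ^ (t + n₀) :=
        Nat.pow_le_pow_right hx ((card_union_le _ _).trans (add_le_add hIt hTcard))
      exact_mod_cast h1.trans h2
    · rw [card_union_of_disjoint hIT]
      have := hIne.card_pos
      have := hTne.card_pos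
      omega
    · intro p hp
      exact hmod.of_dvd (hP p (hsub hp)).2.2.2
    · rw [gcdPredPrimeFactors, Nat.primeFactors_prod (hunion I hIP)]
      obtain ⟨p, hp⟩ := hIne
      obtain ⟨p', hp'⟩ := hTne
      -- One prime from each family bounds the gcd by `ν`; conversely `ν` divides every predecessor,
      -- seen by pairing it with a prime of the other family.
      refine Nat.dvd_antisymm ?_ (Finset.dvd_gcd fun q hq => ?_)
      · rw [← hgcd p (hIP hp) p' (hTP' hp')]
        exact Nat.dvd_gcd (Finset.gcd_dvd (mem_union_left _ hp)) (Finset.gcd_dvd (mem_union_right _ hp'))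
      · rcases mem_union.mp hq with hq | hq
        · rw [← hgcd q (hIP hq) p' (hTP' hp')]
          exact Nat.gcd_dvd_left _ _
        · rw [← hgcd p (hIP hp) q (hTP' hq)]
          exact Nat.gcd_dvd_right _ _
  · intro I hI J hJ h
    simp only [coe_filter, mem_powerset, Set.mem_ofPred_eq] at hI hJ
    have h1 : I ∪ T = J ∪ T := by
      rw [← Nat.primeFactors_prod (hunion I hI.1), ← Nat.primeFactors_prod (hunion J hJ.1)]
      exact congrArg _ h
    have hIT : Disjoint I T := disjoint_of_subset_left hI.1 (disjoint_of_subset_right hTP' hdisj)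
    have hJT : Disjoint J T := disjoint_of_subset_left hJ.1 (disjoint_of_subset_right hTP' hdisj)
    rw [← union_sdiff_cancel_right hIT, h1, union_sdiff_cancel_right hJT]

/-! ### Binomial and asymptotic estimates -/

theorem Nat.pow_le_pow_mul_choose {n k : ℕ} (h : k ≤ n) : n ^ k ≤ k ^ k * n.choose k := by
  induction k generalizing n with
  | zero => simp
  | succ k ih =>
    obtain ⟨n, rfl⟩ : ∃ m, n = m + 1 := ⟨n - 1, by omega⟩
    have hkn : k ≤ n := by omega
    have h1 : (n + 1) ^ k ≤ (k + 1) ^ k * n.choose k := by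
      have hk : 0 < k ^ k := Nat.pow_self_pos
      refine Nat.le_of_mul_le_mul_left ?_ hk
      calc k ^ k * (n + 1) ^ k = (k * (n + 1)) ^ k := by rw [mul_pow]
        _ ≤ ((k + 1) * n) ^ k := by gcongr 1; nlinarith
        _ = (k + 1) ^ k * n ^ k := by rw [mul_pow]
        _ ≤ (k + 1) ^ k * (k ^ k * n.choose k) := by gcongr; exact ih hkn
        _ = _ := by ring
    calc (n + 1) ^ (k + 1) = (n + 1) * (n + 1) ^ k := by ring
      _ ≤ (n + 1) * ((k + 1) ^ k * n.choose k) := by gcongr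
      _ = (k + 1) ^ k * ((n + 1) * n.choose k) := by ring
      _ = (k + 1) ^ k * ((n + 1).choose (k + 1) * (k + 1)) := by rw [Nat.add_one_mul_choose_eq]
      _ = _ := by ring

/-- The form of `(n / k) ^ k ≤ n.choose k` applied to all three choices: of `a` primes up to `z`, of
`z` primes `q`, and of `t` primes in the final product. -/
theorem mul_log_sub_log_le_log_choose {n k : ℕ} (hk : 0 < k) (h : k ≤ n) :
    k * (Real.log n - Real.log k) ≤ Real.log (n.choose k) := by
  have hn : (0 : ℝ) < n := by exact_mod_cast hk.trans_le h
  have hk' : (0 : ℝ) < k := by exact_mod_cast hk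
  have hc : (0 : ℝ) < n.choose k := by exact_mod_cast Nat.choose_pos h
  have h1 : (n : ℝ) ^ k ≤ k ^ k * n.choose k := by exact_mod_cast Nat.pow_le_pow_mul_choose h
  have h2 := Real.log_le_log (by positivity) h1
  rw [Real.log_mul (by positivity) hc.ne', Real.log_pow, Real.log_pow] at h2
  linarith

open Filter in
theorem eventually_mul_log_pow_le (C : ℝ) (k : ℕ) : ∀ᶠ z : ℕ in atTop, C * Real.log z ^ k ≤ z := by
  have h := (isLittleO_log_rpow_rpow_atTop (k : ℝ) one_pos).tendsto_div_nhds_zero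
  have h2 := (h.const_mul C).comp tendsto_natCast_atTop_atTop
  rw [mul_zero] at h2
  filter_upwards [h2.eventually (gt_mem_nhds one_pos), eventually_gt_atTop 0] with z hz hz0
  have : (0 : ℝ) < z := by exact_mod_cast hz0
  simp only [Function.comp, Real.rpow_natCast, Real.rpow_one] at hz
  rw [← mul_div_assoc, div_lt_one this] at hz
  exact hz.le

open Filter in
theorem eventually_pow_mul_pow_le (C : ℝ) (k : ℕ) {b c : ℝ} (hb : 0 < b) (hbc : b < c) :
    ∀ᶠ z : ℕ in atTop, C * (z : ℝ) ^ k * b ^ z < c ^ z := by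
  have h := tendsto_pow_const_div_const_pow_of_one_lt k ((one_lt_div hb).mpr hbc)
  have h2 := h.const_mul C
  rw [mul_zero] at h2
  filter_upwards [h2.eventually (gt_mem_nhds one_pos)] with z hz
  have hbz : 0 < b ^ z := by positivity
  have hcz : 0 < c ^ z := pow_pos (hb.trans hbc) _
  rw [div_pow, ← mul_div_assoc, div_lt_one (by positivity), lt_div_iff₀ hbz] at hz
  exact hz

open Filter in
theorem tendsto_log_natCast_atTop : Tendsto (fun z : ℕ => Real.log z) atTop atTop :=
  Real.tendsto_log_atTop.comp tendsto_natCast_atTop_atTop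

open Filter in
theorem eventually_log_log_le (C : ℝ) :
    ∀ᶠ z : ℕ in atTop, C * Real.log (Real.log z) ≤ Real.log z := by
  have h := (Real.isLittleO_log_id_atTop.tendsto_div_nhds_zero.const_mul C).comp
    tendsto_log_natCast_atTop
  rw [mul_zero] at h
  filter_upwards [h.eventually (gt_mem_nhds one_pos),
    tendsto_log_natCast_atTop.eventually_gt_atTop 0] with z hz hz0
  simp only [Function.comp, id] at hz
  rw [← mul_div_assoc, div_lt_one hz0] at hz
  exact hz.le

open Filter in
theorem eventually_div_log_le_primeCounting :
    ∀ᶠ z : ℕ in atTop, (z : ℝ) / (2 * Real.log z) ≤ Nat.primeCounting z := by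
  filter_upwards [eventually_mul_log_pow_le 20 1, tendsto_log_natCast_atTop.eventually_ge_atTop 1,
    eventually_ge_atTop 2] with z h1 h2 h3
  refine le_trans ?_ (Chebyshev.pi_ge z)
  have hz : (2 : ℝ) ≤ z := by exact_mod_cast h3
  have h4 : Real.log (z + 1) ≤ 2 * Real.log z := by
    rw [← Nat.cast_ofNat, ← Real.log_pow]
    exact Real.log_le_log (by positivity) (by nlinarith)
  have h5 := Real.log_two_gt_d9
  rw [pow_one] at h1
  rw [← div_div]
  gcongr
  nlinarith

/-! ### Choice of parameters -/

theorem Real.rpow_le_pow_of_le {t w A : ℝ} {B : ℕ} (ht : 0 ≤ t) (htw : t ≤ w) (hw : 1 ≤ w)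
    (hA : 0 ≤ A) (hAB : A ≤ B) : t ^ A ≤ w ^ B := by
  calc t ^ A ≤ w ^ A := Real.rpow_le_rpow ht htw hA
    _ ≤ w ^ (B : ℝ) := Real.rpow_le_rpow_of_exponent_le hw hAB
    _ = w ^ B := Real.rpow_natCast w B

set_option maxHeartbeats 1000000 in
open Filter in
/-- For large `z` there are parameters satisfying the hypotheses of `exists_prime_families` with
`b = z`, for which the families are as large as the lower bound of `carmichaelCount` needs. -/
theorem eventually_exists_parameters {A : ℝ} (hA : 0 ≤ A) (l₀ ν : ℕ) (hν : 0 < ν) :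
    ∃ C : ℝ, 0 ≤ C ∧ ∀ᶠ z : ℕ in atTop, ∃ a K₁ K₀ K y n : ℕ,
      2 * Real.log (2 * (z ^ a : ℕ)) ^ A ≤ K₁ ∧ a ≤ Nat.primeCounting z ∧ l₀ ≤ 2 ^ a ∧ l₀ ≤ 2 ^ z ∧
      z ^ a * K₁ + 1 ≤ y ∧ ν * Real.log (ν * (y ^ z : ℕ)) ^ A ≤ K₀ ∧
      (ν * K₀) * Real.log (ν * K₀ * (y ^ z : ℕ)) ^ A ≤ K ∧ K₀ ≤ K ∧
      K₁ * (2 * n + K) ≤ (Nat.primeCounting z).choose a ∧ z ≤ n ∧ 0 < z ∧ y < 2 ^ z ∧ ν < 2 ^ z ∧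
      0 < K ∧ 0 < y ∧
      (K * K * (K₁ * 4 ^ z) : ℝ) * Real.log (K * K * (y : ℝ) ^ (2 * n)) < 9 ^ z ∧
      z * Real.log z ^ 2 ≤ Real.log (y ^ z * K + 1 : ℕ) ∧ Real.log (y ^ z * K + 1 : ℕ) ≤ z ^ 2 ∧
      ∀ r : ℕ, n.choose z ≤ K * r → 9 ^ z ≤ r ∧ Real.log (y ^ z * K + 1 : ℕ) *
        (1 - (2 * Real.log (Real.log z) + C) / Real.log z) ≤ Real.log r := by
  obtain ⟨B, hAB⟩ := exists_nat_ge A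
  -- These exponents make `K₁ = a ^ D` dominate `a * (a ^ 3) ^ B`, and `K = z ^ E` dominate `z * z ^
  -- (2 * B + 1) * (z ^ 2) ^ B`, where `B ≥ A`.
  obtain ⟨D, hD⟩ : ∃ D : ℕ, D = 3 * B + 1 := ⟨_, rfl⟩
  obtain ⟨E, hE⟩ : ∃ E : ℕ, E = 4 * B + 2 := ⟨_, rfl⟩
  -- Both `log K₁` and `log K` are lost twice, once in bounding `x` and once by pigeonhole; the `8`
  -- collects the remaining multiples of `z * a`.
  refine ⟨2 * D + 2 * E + 8, by positivity, ?_⟩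
  filter_upwards [eventually_mul_log_pow_le (2 * (3 + 2 * D)) 2, eventually_mul_log_pow_le (2 * E) 1,
    eventually_log_log_le 8, eventually_div_log_le_primeCounting,
    eventually_pow_mul_pow_le 2 (2 * E + D + 1) (by norm_num : (0 : ℝ) < 8) (by norm_num : (8 : ℝ) < 9),
    tendsto_log_natCast_atTop.eventually_ge_atTop (l₀ + 16 * (2 * D + 2 * E + 8)),
    eventually_ge_atTop (max (max ν l₀) 16)]
    with z h1 h2 h3 h4 h5 h6 h7
  have hzν : ν ≤ z := (le_max_left _ _).trans ((le_max_left _ _).trans h7)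
  have hzl : l₀ ≤ z := (le_max_right _ _).trans ((le_max_left _ _).trans h7)
  have hz16 : 16 ≤ z := (le_max_right _ _).trans h7
  clear h7
  obtain ⟨ℓ, hℓ⟩ : ∃ ℓ, ℓ = Real.log z := ⟨_, rfl⟩
  simp only [← hℓ] at h1 h2 h3 h4 h6 ⊢
  obtain ⟨a, ha⟩ : ∃ a : ℕ, a = ⌊ℓ⌋₊ + 1 := ⟨_, rfl⟩
  have hD0 : (0 : ℝ) ≤ D := by positivity
  have hE0 : (0 : ℝ) ≤ E := by positivity
  have hl0 : (0 : ℝ) ≤ l₀ := by positivity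
  have hℓbig : 16 * (2 * D + 2 * E + 8 : ℝ) ≤ ℓ := by linarith
  have hℓ1 : 128 ≤ ℓ := by linarith
  have hℓ0 : 0 < ℓ := by linarith
  have hz0 : (0 : ℝ) < z := by exact_mod_cast (by omega : 0 < z)
  have hz16r : (16 : ℝ) ≤ z := by exact_mod_cast hz16
  have ha1 : ℓ ≤ a := by
    rw [ha]; push_cast; exact (Nat.lt_floor_add_one ℓ).le
  have ha2 : (a : ℝ) ≤ 2 * ℓ := by
    rw [ha]; push_cast; linarith [Nat.floor_le hℓ0.le]
  have ha0 : (0 : ℝ) < a := by linarith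
  have ha0' : 0 < a := by omega
  have hlog2 : Real.log 2 ≤ 1 := by linarith [Real.log_two_lt_d9]
  have hlog2' : 0 ≤ Real.log 2 := by linarith [Real.log_two_gt_d9]
  have hlogℓ0 : 0 ≤ Real.log ℓ := Real.log_nonneg (by linarith)
  have hloga : Real.log a ≤ Real.log ℓ + 1 := by
    calc Real.log a ≤ Real.log (2 * ℓ) := Real.log_le_log ha0 ha2
      _ = Real.log 2 + Real.log ℓ := Real.log_mul (by norm_num) hℓ0.ne'
      _ ≤ _ := by linarith
  have hloga0 : 0 ≤ Real.log a := Real.log_nonneg (by linarith)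
  have hloga' : Real.log a ≤ a := Real.log_le_self ha0.le
  have hℓsq : 128 * ℓ ≤ ℓ ^ 2 := by rw [pow_two]; gcongr
  have hzsq : 16 * z ≤ (z : ℝ) ^ 2 := by rw [pow_two]; gcongr
  have hDℓ : 2 * (3 + 2 * D) * ℓ ^ 2 = 6 * ℓ ^ 2 + 4 * (D * ℓ ^ 2) := by ring
  have hDℓ0 : 0 ≤ D * ℓ ^ 2 := by positivity
  have haz : (a : ℝ) ≤ z := by linarith
  obtain ⟨K₁, hK₁⟩ : ∃ K₁ : ℕ, K₁ = a ^ D := ⟨_, rfl⟩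
  obtain ⟨y, hy⟩ : ∃ y : ℕ, y = z ^ a * K₁ + 1 := ⟨_, rfl⟩
  have hK₁pos : 0 < K₁ := by rw [hK₁]; positivity
  have hlogK₁ : Real.log K₁ = D * Real.log a := by rw [hK₁]; push_cast; rw [Real.log_pow]
  have hy0 : 0 < y := by omega
  have hlogy0 : 0 ≤ Real.log y := Real.log_natCast_nonneg y
  have hlogy : Real.log y ≤ Real.log 2 + a * ℓ + D * Real.log a := by
    have : (y : ℝ) ≤ 2 * ((z : ℝ) ^ a * K₁) := by
      have h : 1 ≤ z ^ a * K₁ := Nat.succ_le_of_lt (by positivity)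
      have h' : (1 : ℝ) ≤ (z : ℝ) ^ a * K₁ := by exact_mod_cast h
      rw [hy]; push_cast; linarith
    refine (Real.log_le_log (by exact_mod_cast hy0) this).trans ?_
    have hK₁r : (K₁ : ℝ) ≠ 0 := by positivity
    rw [Real.log_mul (by norm_num) (by positivity), Real.log_mul (by positivity) hK₁r, Real.log_pow,
      hlogK₁, ← hℓ, add_assoc]
  have hlogy2 : Real.log y ≤ z / 2 := by
    have e1 : a * ℓ ≤ 2 * ℓ ^ 2 := by
      calc a * ℓ ≤ 2 * ℓ * ℓ := by gcongr
        _ = _ := by ring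
    have e2 : D * Real.log a ≤ 2 * D * ℓ ^ 2 := by
      calc D * Real.log a ≤ D * (2 * ℓ ^ 2) := by gcongr; linarith
        _ = _ := by ring
    have e3 : Real.log 2 ≤ ℓ ^ 2 := by linarith
    linarith
  have hzℓ : ℓ ≤ z := hℓ ▸ Real.log_le_self hz0.le
  have hEℓ : E * ℓ ≤ z / 2 := by rw [pow_one] at h2; linarith
  have hlogν : Real.log ν ≤ z :=
    (Real.log_le_self (by positivity)).trans (by exact_mod_cast hzν)
  have hlogν0 : 0 ≤ Real.log ν := Real.log_natCast_nonneg ν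
  have hνr : (0 : ℝ) < ν := by exact_mod_cast hν
  have hyr : (0 : ℝ) < y := by exact_mod_cast hy0
  have hνz : (ν : ℝ) ≤ z := by exact_mod_cast hzν
  obtain ⟨Ch, hCh⟩ : ∃ Ch : ℕ, Ch = (Nat.primeCounting z).choose a := ⟨_, rfl⟩
  obtain ⟨K, hK⟩ : ∃ K : ℕ, K = z ^ E := ⟨_, rfl⟩
  have hlogK : Real.log K = E * ℓ := by rw [hK]; push_cast; rw [Real.log_pow, ← hℓ]
  have hKpos : 0 < K := by rw [hK]; positivity
  have hKr : (0 : ℝ) < K := by exact_mod_cast hKpos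
  have hK₁r : (0 : ℝ) < K₁ := by exact_mod_cast hK₁pos
  have haπ : (a : ℝ) ≤ Nat.primeCounting z := by
    refine ha2.trans (le_trans ?_ h4)
    rw [le_div_iff₀ (by positivity), show 2 * ℓ * (2 * ℓ) = 4 * ℓ ^ 2 by ring]
    linarith
  have haπ' : a ≤ Nat.primeCounting z := by exact_mod_cast haπ
  -- The source of `2 log ℓ`: one `log ℓ` comes from `π(z) ≥ z / (2ℓ)`, the other from `log a`.
  have hlogCh : a * (ℓ - 2 * Real.log ℓ - 2) ≤ Real.log Ch := by
    rw [hCh]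
    refine le_trans ?_ (mul_log_sub_log_le_log_choose ha0' haπ')
    have e1 : ℓ - Real.log ℓ - 1 ≤ Real.log (Nat.primeCounting z) := by
      refine le_trans ?_ (Real.log_le_log (by positivity) h4)
      rw [Real.log_div hz0.ne' (by positivity), Real.log_mul (by norm_num) hℓ0.ne']
      linarith
    exact mul_le_mul_of_nonneg_left (by linarith) ha0.le
  have hCh0 : (0 : ℝ) < Ch := by exact_mod_cast hCh ▸ Nat.choose_pos haπ'
  have hChK : 2 * K₁ * K ≤ Ch := by
    have : (2 * K₁ * K : ℝ) ≤ Ch := by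
      rw [← Real.log_le_log_iff (by positivity) hCh0, Real.log_mul (by positivity) hKr.ne',
        Real.log_mul (by norm_num) hK₁r.ne', hlogK₁, hlogK]
      refine le_trans ?_ hlogCh
      have e1 : D * Real.log a ≤ D * (2 * ℓ) := by gcongr; linarith
      have e2 : ℓ * (ℓ / 2) ≤ a * (ℓ - 2 * Real.log ℓ - 2) := by
        refine mul_le_mul ha1 (by linarith) (by positivity) ha0.le
      have e3 : 16 * (2 * D + 2 * E + 8 : ℝ) * ℓ ≤ ℓ * ℓ := by gcongr
      linarith [mul_nonneg hD0 hℓ0.le, mul_nonneg hE0 hℓ0.le]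
    exact_mod_cast this
  -- With this `n`, each of `2 * n * K₁` and `K₁ * K` is at most half of `Ch`.
  obtain ⟨n, hn⟩ : ∃ n : ℕ, n = Ch / (4 * K₁) := ⟨_, rfl⟩
  have hn4 : 4 * K₁ * n ≤ Ch := hn ▸ Nat.mul_div_le _ _
  have hKz : 2 * z ≤ K := by
    rw [hK, hE]
    calc 2 * z ≤ z * z := by gcongr; omega
      _ = z ^ 2 := by ring
      _ ≤ z ^ (4 * B + 2) := Nat.pow_le_pow_right (by omega) (by omega)
  have hzn : z ≤ n := by
    rw [hn, Nat.le_div_iff_mul_le (by positivity)]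
    calc z * (4 * K₁) = 2 * K₁ * (2 * z) := by ring
      _ ≤ 2 * K₁ * K := by gcongr
      _ ≤ Ch := hChK
  have hn8 : Ch ≤ 8 * K₁ * n := by
    have e1 : Ch < 4 * K₁ * (n + 1) := hn ▸ Nat.lt_mul_div_succ _ (by positivity)
    have e2 : 4 * K₁ * (n + 1) ≤ 4 * K₁ * (n + n) := by gcongr; omega
    calc Ch ≤ 4 * K₁ * (n + n) := e1.le.trans e2
      _ = _ := by ring
  have hnr : (0 : ℝ) < n := by exact_mod_cast (by omega : 0 < n)
  have hlogn : Real.log Ch ≤ 3 + D * Real.log a + Real.log n := by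
    have : (Ch : ℝ) ≤ 8 * K₁ * n := by exact_mod_cast hn8
    refine (Real.log_le_log hCh0 this).trans ?_
    rw [Real.log_mul (by positivity) hnr.ne', Real.log_mul (by norm_num) hK₁r.ne', hlogK₁,
      show (8 : ℝ) = 2 ^ 3 by norm_num, Real.log_pow]
    push_cast
    linarith
  have hy2z : y < 2 ^ z := by
    have : (y : ℝ) < 2 ^ z := by
      rw [← Real.log_lt_log_iff hyr (by positivity), Real.log_pow]
      calc Real.log y ≤ z * (1 / 2) := by linarith
        _ < z * Real.log 2 := by gcongr; linarith [Real.log_two_gt_d9]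
    exact_mod_cast this
  have hz2 : z < 2 ^ z := Nat.lt_two_pow_self
  have ha2a : a < 2 ^ a := Nat.lt_two_pow_self
  have hla : l₀ ≤ a := by
    have : (l₀ : ℝ) ≤ a := by linarith
    exact_mod_cast this
  have hcond1 : 2 * Real.log (2 * (z ^ a : ℕ)) ^ A ≤ K₁ := by
    have e0 : 0 ≤ Real.log (2 * (z ^ a : ℕ)) := by
      refine Real.log_nonneg ?_
      have : (1 : ℝ) ≤ (z ^ a : ℕ) := by exact_mod_cast Nat.one_le_pow _ _ (by omega)
      linarith
    have e1 : Real.log (2 * (z ^ a : ℕ)) ≤ (a : ℝ) ^ 3 := by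
      push_cast
      rw [Real.log_mul (by norm_num) (by positivity), Real.log_pow]
      rw [← hℓ]
      have f1 : a * ℓ ≤ a * a := by gcongr
      have f2 : (128 : ℝ) * (a * a) ≤ a * (a * a) := by gcongr; linarith
      have f3 : 1 * 1 ≤ (a : ℝ) * a := by gcongr <;> linarith
      have f4 : (a : ℝ) ^ 3 = a * (a * a) := by ring
      linarith
    calc 2 * Real.log (2 * (z ^ a : ℕ)) ^ A ≤ a * ((a : ℝ) ^ 3) ^ B := by
          have f2 : (128 : ℝ) ≤ a := by linarith
          gcongr
          · linarith
          · exact Real.rpow_le_pow_of_le e0 e1 (one_le_pow₀ (by linarith)) hA hAB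
      _ = K₁ := by rw [hK₁, hD]; push_cast; ring
  have hcond2 : ∀ j : ℕ, 0 < j → Real.log j ≤ z →
      Real.log (ν * j * (y ^ z : ℕ)) ^ A ≤ ((z : ℝ) ^ 2) ^ B := by
    intro j hj hjz
    have hjr : (0 : ℝ) < j := by exact_mod_cast hj
    have e0 : 0 ≤ Real.log (ν * j * (y ^ z : ℕ)) := by
      have : (ν * j * (y ^ z : ℕ) : ℝ) = ((ν * j * y ^ z : ℕ) : ℝ) := by push_cast; ring
      rw [this]
      exact Real.log_natCast_nonneg _
    refine Real.rpow_le_pow_of_le e0 ?_ (one_le_pow₀ (by linarith)) hA hAB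
    push_cast
    rw [Real.log_mul (by positivity) (by positivity), Real.log_mul hνr.ne' hjr.ne', Real.log_pow]
    have e1 : z * Real.log y ≤ z * (z / 2) := by gcongr
    linarith
  obtain ⟨K₀, hK₀⟩ : ∃ K₀ : ℕ, K₀ = z ^ (2 * B + 1) := ⟨_, rfl⟩
  have hcond3 : ν * Real.log (ν * (y ^ z : ℕ)) ^ A ≤ K₀ := by
    have := hcond2 1 one_pos (by simp)
    rw [Nat.cast_one, mul_one] at this
    calc ν * Real.log (ν * (y ^ z : ℕ)) ^ A ≤ ν * ((z : ℝ) ^ 2) ^ B := mul_le_mul_of_nonneg_left this hνr.le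
      _ ≤ z * ((z : ℝ) ^ 2) ^ B := by gcongr
      _ = K₀ := by rw [hK₀]; push_cast; ring
  have hcond4 : (ν * K₀) * Real.log (ν * K₀ * (y ^ z : ℕ)) ^ A ≤ K := by
    have := hcond2 K₀ (by rw [hK₀]; positivity) (by
      rw [hK₀]; push_cast; rw [Real.log_pow, ← hℓ]
      refine le_trans ?_ (hEℓ.trans (by linarith))
      have : ((2 * B + 1 : ℕ) : ℝ) ≤ E := by exact_mod_cast (by omega : 2 * B + 1 ≤ E)
      exact mul_le_mul_of_nonneg_right this hℓ0.le)
    calc (ν * K₀) * Real.log (ν * K₀ * (y ^ z : ℕ)) ^ A ≤ (ν * K₀) * ((z : ℝ) ^ 2) ^ B :=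
          mul_le_mul_of_nonneg_left this (by positivity)
      _ ≤ (z * K₀) * ((z : ℝ) ^ 2) ^ B := by gcongr
      _ = K := by rw [hK₀, hK, hE]; push_cast; ring
  have hcond5 : K₁ * (2 * n + K) ≤ Ch := by
    have : 2 * (K₁ * (2 * n + K)) ≤ 2 * Ch := by
      calc 2 * (K₁ * (2 * n + K)) = 4 * K₁ * n + 2 * K₁ * K := by ring
        _ ≤ Ch + Ch := add_le_add hn4 hChK
        _ = 2 * Ch := by ring
    omega
  obtain ⟨x, hx⟩ : ∃ x : ℕ, x = y ^ z * K + 1 := ⟨_, rfl⟩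
  have hxr : (0 : ℝ) < x := by rw [hx]; positivity
  have hlogx1 : z * (a * ℓ) ≤ Real.log x := by
    have e1 : (z ^ a) ^ z ≤ x := by
      calc (z ^ a) ^ z ≤ y ^ z := by
            gcongr
            rw [hy]
            exact (Nat.le_mul_of_pos_right _ hK₁pos).trans (Nat.le_succ _)
        _ ≤ y ^ z * K := Nat.le_mul_of_pos_right _ hKpos
        _ ≤ x := hx ▸ Nat.le_succ _
    have e2 : ((z : ℝ) ^ a) ^ z ≤ x := by exact_mod_cast e1
    have e3 := Real.log_le_log (by positivity) e2
    rwa [Real.log_pow, Real.log_pow, ← hℓ] at e3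
  have hlogx2 : Real.log x ≤ 1 + z * Real.log y + E * ℓ := by
    have e1 : (x : ℝ) ≤ 2 * ((y : ℝ) ^ z * K) := by
      have h : 1 ≤ y ^ z * K := Nat.succ_le_of_lt (by positivity)
      have h' : (1 : ℝ) ≤ (y : ℝ) ^ z * K := by exact_mod_cast h
      rw [hx]; push_cast; linarith
    refine (Real.log_le_log hxr e1).trans ?_
    rw [Real.log_mul (by norm_num) (by positivity), Real.log_mul (by positivity) hKr.ne', Real.log_pow,
      hlogK]
    linarith
  have hza : (a : ℝ) ≤ z * a := le_mul_of_one_le_left ha0.le (by linarith)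
  have hη : (2 * Real.log ℓ + (2 * D + 2 * E + 8)) / ℓ ≤ 1 / 2 := by
    rw [div_le_iff₀ hℓ0]; linarith
  have hcardlog : ∀ r : ℕ, n.choose z ≤ K * r →
      Real.log x * (1 - (2 * Real.log ℓ + (2 * D + 2 * E + 8)) / ℓ) ≤ Real.log r := by
    intro r hr
    have hc : (0 : ℝ) < n.choose z := by exact_mod_cast Nat.choose_pos hzn
    have hr' : (n.choose z : ℝ) ≤ K * r := by exact_mod_cast hr
    have hr0 : (0 : ℝ) < r := pos_of_mul_pos_right (hc.trans_le hr') hKr.le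
    have e1 := Real.log_le_log hc hr'
    rw [Real.log_mul hKr.ne' hr0.ne', hlogK] at e1
    have e2 := mul_log_sub_log_le_log_choose (by omega) hzn
    rw [← hℓ] at e2
    have e3 : Real.log x - Real.log r ≤
        z * a * (2 * Real.log ℓ + (2 * D + 2 * E + 8)) := by
      have f1 : z * Real.log y ≤ z * (Real.log 2 + a * ℓ + D * Real.log a) := by gcongr
      have f2 : z * (a * (ℓ - 2 * Real.log ℓ - 2)) ≤ z * (3 + D * Real.log a + Real.log n) := by
        gcongr; linarith
      have f3 : z * (Real.log 2 + 3 + ℓ) ≤ z * (5 * a) := by gcongr; linarith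
      have f4 : z * (D * Real.log a) ≤ z * (D * a) := by gcongr
      have f5 : E * ℓ ≤ E * (z * a) := by gcongr; linarith
      have f6 : z * a * (2 * Real.log ℓ + (2 * D + 2 * E + 8)) = 2 * (z * (a * Real.log ℓ)) +
        2 * (z * (D * a)) + 2 * (E * (z * a)) + 8 * (z * a) := by ring
      have f7 : 0 ≤ E * (z * a : ℝ) := by positivity
      linarith
    have e4 : z * a * (2 * Real.log ℓ + (2 * D + 2 * E + 8)) ≤
        Real.log x * ((2 * Real.log ℓ + (2 * D + 2 * E + 8)) / ℓ) := by
      calc z * a * (2 * Real.log ℓ + (2 * D + 2 * E + 8))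
          = (z * (a * ℓ)) * ((2 * Real.log ℓ + (2 * D + 2 * E + 8)) / ℓ) := by
            field_simp
        _ ≤ _ := by gcongr
    linarith
  have hlogx3 : z * ℓ ^ 2 ≤ Real.log x := by
    refine le_trans ?_ hlogx1
    rw [pow_two]
    gcongr
  have hlogx4 : Real.log x ≤ z ^ 2 := by
    have e1 : z * Real.log y ≤ z * (z / 2) := by gcongr
    have e3 : z * (z / 2 : ℝ) = z ^ 2 / 2 := by ring
    linarith
  have hπz : Nat.primeCounting z ≤ z := by
    rw [← Nat.primesLE_card_eq_primeCounting]
    calc (Nat.primesLE z).card ≤ (Finset.Icc 1 z).card := Finset.card_le_card fun p hp =>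
          Finset.mem_Icc.mpr ⟨(Nat.prime_of_mem_primesLE hp).pos, Nat.le_of_mem_primesLE hp⟩
      _ = z := by simp
  have hn2 : n ≤ 2 ^ z := by
    calc n ≤ Ch := hn ▸ Nat.div_le_self _ _
      _ ≤ 2 ^ Nat.primeCounting z := hCh ▸ Nat.choose_le_two_pow _ _
      _ ≤ 2 ^ z := Nat.pow_le_pow_right (by omega) hπz
  have hlogN : Real.log (K * K * (y : ℝ) ^ (2 * n)) ≤ 2 * z * 2 ^ z := by
    have hn2' : (n : ℝ) ≤ 2 ^ z := by exact_mod_cast hn2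
    rw [Real.log_mul (by positivity) (by positivity), Real.log_mul hKr.ne' hKr.ne', Real.log_pow,
      hlogK]
    push_cast
    have e2 : 2 * (n : ℝ) * Real.log y ≤ 2 * 2 ^ z * (z / 2) := by gcongr
    have e3 : (z : ℝ) * 1 ≤ z * 2 ^ z := by
      gcongr
      exact one_le_pow₀ (by norm_num)
    linarith
  -- The factor `4 ^ z` from the primorial and `2 ^ z` from `n` give `8 ^ z` times a power of `z`,
  -- which is below `9 ^ z`.
  have hMN : (K * K * (K₁ * 4 ^ z) : ℝ) * Real.log (K * K * (y : ℝ) ^ (2 * n)) < 9 ^ z := by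
    have hK₁z : (K₁ : ℝ) ≤ (z : ℝ) ^ D := by
      rw [hK₁]; push_cast; gcongr
    calc (K * K * (K₁ * 4 ^ z) : ℝ) * Real.log (K * K * (y : ℝ) ^ (2 * n))
        ≤ (K * K * ((z : ℝ) ^ D * 4 ^ z)) * (2 * z * 2 ^ z) := by
          refine mul_le_mul (by gcongr) hlogN ?_ (by positivity)
          have := Real.log_natCast_nonneg (K * K * y ^ (2 * n))
          push_cast at this
          exact this
      _ = 2 * (z : ℝ) ^ (2 * E + D + 1) * 8 ^ z := by
          rw [hK, show (8 : ℝ) = 4 * 2 by norm_num, mul_pow]; push_cast; ring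
      _ < 9 ^ z := h5
  refine ⟨a, K₁, K₀, K, y, n, hcond1, haπ', hla.trans ha2a.le, hzl.trans hz2.le, hy.ge, hcond3,
    hcond4, ?_, hCh ▸ hcond5, hzn, by omega, hy2z, hzν.trans_lt hz2, hKpos, hy0, hMN, ?_, ?_,
    fun r hr => ⟨?_, ?_⟩⟩
  · rw [hK₀, hK]
    exact Nat.pow_le_pow_right (by omega) (by omega)
  · rw [← hx]; exact hlogx3
  · rw [← hx]; exact hlogx4
  · have hr0 : 0 < r := by
      rw [Nat.pos_iff_ne_zero]
      rintro rfl
      exact (Nat.choose_pos hzn).ne' (Nat.le_zero.mp hr)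
    have hr0' : (0 : ℝ) < r := by exact_mod_cast hr0
    have : ((9 : ℝ) ^ z) ≤ r := by
      rw [← Real.log_le_log_iff (by positivity) hr0', Real.log_pow]
      have e2 : Real.log 9 ≤ 8 := by linarith [Real.log_le_sub_one_of_pos (by norm_num : (0 : ℝ) < 9)]
      have hx0 : 0 ≤ Real.log x := Real.log_natCast_nonneg x
      calc z * Real.log 9 ≤ z * 8 := by gcongr
        _ ≤ z * (ℓ ^ 2 * (1 / 2)) := by
            have f1 : 128 * 128 ≤ ℓ ^ 2 := by rw [pow_two]; gcongr
            exact mul_le_mul_of_nonneg_left (by linarith) hz0.le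
        _ = z * ℓ ^ 2 * (1 / 2) := by ring
        _ ≤ Real.log x * (1 / 2) := by gcongr
        _ ≤ Real.log x * (1 - (2 * Real.log ℓ + (2 * D + 2 * E + 8)) / ℓ) :=
            mul_le_mul_of_nonneg_left (by linarith) hx0
        _ ≤ _ := hcardlog r hr
    exact_mod_cast this
  · rw [← hx]; exact hcardlog r hr

/-! ### The lower bound in terms of `z` -/

open Filter in
/-- Under Heath-Brown's conjecture, families as in `exists_prime_families` exist with the sizes needed
for the lower bound of `carmichaelCount`. -/
theorem eventually_exists_prime_families {A : ℝ} (hA : 0 ≤ A) {l₀ : ℕ}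
    (hHB : ∀ l : ℕ, l₀ ≤ l → ∀ b : ℕ, Nat.Coprime b l →
      ∃ p : ℕ, p.Prime ∧ p ≡ b [MOD l] ∧ (p : ℝ) < (l : ℝ) * Real.log (l : ℝ) ^ A)
    (ν : ℕ) (hν : 0 < ν) (hν2 : Even ν) :
    ∃ C : ℝ, 0 ≤ C ∧ ∀ᶠ z : ℕ in atTop, ∃ (N M x : ℕ) (P P' : Finset ℕ), 0 < N ∧ 0 < M ∧
      M * Real.log N < (9 ^ z : ℕ) ∧ (∀ c, Nat.Coprime c N → c ^ M ≡ 1 [MOD N]) ∧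
      (∀ p ∈ P ∪ P', p.Prime ∧ p ≤ x ∧ Nat.Coprime p N ∧ p - 1 ∣ N) ∧
      (∀ p ∈ P, ∀ p' ∈ P', Nat.gcd (p - 1) (p' - 1) = ν) ∧ Disjoint P P' ∧
      9 ^ z ≤ P.card ∧ 9 ^ z ≤ P'.card ∧ 0 < x ∧
      z * Real.log z ^ 2 ≤ Real.log x ∧ Real.log x ≤ z ^ 2 ∧
      Real.log x * (1 - (2 * Real.log (Real.log z) + C) / Real.log z) ≤ Real.log P.card := by
  obtain ⟨C, hC, hev⟩ := eventually_exists_parameters hA l₀ ν hν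
  refine ⟨C, hC, hev.mono fun z hz => ?_⟩
  obtain ⟨a, K₁, K₀, K, y, n, h1, h2, h3, h4, h5, h6, h7, h8, h9, h10, h11, h12, h13, hK, hy, h14, h15,
    h16, h17⟩ := hz
  obtain ⟨N, M, P, P', hN, hM, hNle, hMle, hNM, hP, hgcd, hdisj, hPcard, hPcard'⟩ :=
    exists_prime_families hA hHB ν hν hν2 z a z K₁ K₀ K y n h1 h2 h3 h4 h5 h6 h7 h8 h9 h10 h11 h12 h13
  refine ⟨N, M, y ^ z * K + 1, P, P', hN, hM, ?_, hNM, hP, hgcd, hdisj, (h17 _ hPcard).1,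
    (h17 _ hPcard').1, Nat.succ_pos _, h15, h16, (h17 _ hPcard).2⟩
  have e1 : (N : ℝ) ≤ K * K * (y : ℝ) ^ (2 * n) := by exact_mod_cast hNle
  have e2 : (M : ℝ) ≤ K * K * (K₁ * 4 ^ z) := by exact_mod_cast hMle
  have e3 : Real.log N ≤ Real.log (K * K * (y : ℝ) ^ (2 * n)) :=
    Real.log_le_log (by exact_mod_cast hN) e1
  calc M * Real.log N ≤ (K * K * (K₁ * 4 ^ z) : ℝ) * Real.log (K * K * (y : ℝ) ^ (2 * n)) :=
        mul_le_mul e2 e3 (Real.log_natCast_nonneg N) (by positivity)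
    _ < 9 ^ z := h14
    _ = (9 ^ z : ℕ) := by push_cast; rfl

/-- The lower bound for `carmichaelCount` in terms of the auxiliary parameter `z`. -/
theorem le_log_carmichaelCount {ν N M x z : ℕ} {P P' : Finset ℕ} {C Λ : ℝ} (hC : 0 ≤ C)
    (hN : 0 < N) (hM : 0 < M) (hMN : M * Real.log N < (9 ^ z : ℕ))
    (hNM : ∀ c, Nat.Coprime c N → c ^ M ≡ 1 [MOD N])
    (hP : ∀ p ∈ P ∪ P', p.Prime ∧ p ≤ x ∧ Nat.Coprime p N ∧ p - 1 ∣ N)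
    (hgcd : ∀ p ∈ P, ∀ p' ∈ P', Nat.gcd (p - 1) (p' - 1) = ν) (hdisj : Disjoint P P')
    (hPcard : 9 ^ z ≤ P.card) (hPcard' : 9 ^ z ≤ P'.card) (hx : 0 < x)
    (hx1 : z * Real.log z ^ 2 ≤ Real.log x) (hx2 : Real.log x ≤ z ^ 2)
    (hlogP : Real.log x * (1 - (2 * Real.log (Real.log z) + C) / Real.log z) ≤ Real.log P.card)
    (hz : 1 ≤ z) (hℓ : 32 ≤ Real.log z) (hη : (2 * Real.log (Real.log z) + C) / Real.log z ≤ 1 / 2)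
    (hz9 : 3 * (z : ℝ) ^ 3 * 9 ^ z ≤ Real.exp 8 ^ z)
    (hΛ1 : Real.exp (8 * z) ≤ Λ) (hΛ2 : Λ ≤ Real.exp (8 * z + 8)) :
    0 < carmichaelCount ν (Real.exp Λ) ∧
    Λ * (1 - (2 * Real.log (Real.log z) + (C + 17)) / Real.log z) ≤
      Real.log (carmichaelCount ν (Real.exp Λ)) := by
  obtain ⟨ℓ, hℓdef⟩ : ∃ ℓ, ℓ = Real.log z := ⟨_, rfl⟩
  obtain ⟨Lx, hLx⟩ : ∃ Lx, Lx = Real.log x := ⟨_, rfl⟩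
  simp only [← hℓdef] at hx1 hlogP hℓ hη ⊢
  rw [← hLx] at hx1 hx2 hlogP
  obtain ⟨η, hηdef⟩ : ∃ η, η = (2 * Real.log ℓ + C) / ℓ := ⟨_, rfl⟩
  rw [← hηdef] at hlogP hη
  have hℓ0 : 0 < ℓ := by linarith
  have hη0 : 0 ≤ η := by
    rw [hηdef]
    have : 0 ≤ Real.log ℓ := Real.log_nonneg (by linarith)
    positivity
  have hz1 : (1 : ℝ) ≤ z := by exact_mod_cast hz
  have hzℓ : ℓ ≤ z := hℓdef ▸ Real.log_le_self (by linarith)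
  have hLxz : 32 * (z * ℓ) ≤ Lx := by
    refine le_trans ?_ hx1
    calc 32 * (z * ℓ) ≤ ℓ * (z * ℓ) := by gcongr
      _ = z * ℓ ^ 2 := by ring
  have hzℓ' : (z : ℝ) * 32 ≤ z * ℓ := by gcongr
  have hLxpos : 0 < Lx := by linarith
  have hΛpos : 0 < Λ := (Real.exp_pos _).trans_le hΛ1
  obtain ⟨n₀, hn₀⟩ : ∃ n₀ : ℕ, n₀ = 9 ^ z := ⟨_, rfl⟩
  rw [← hn₀] at hMN hPcard hPcard'
  have hn₀1 : (1 : ℝ) ≤ n₀ := by rw [hn₀]; exact_mod_cast Nat.one_le_pow _ _ (by norm_num)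
  have hsmall : (2 * n₀ + 1) * Lx * ℓ ≤ Λ := by
    calc (2 * n₀ + 1) * Lx * ℓ ≤ (3 * n₀) * z ^ 2 * z := by gcongr; linarith
      _ = 3 * (z : ℝ) ^ 3 * 9 ^ z := by rw [hn₀]; push_cast; ring
      _ ≤ Real.exp 8 ^ z := hz9
      _ = Real.exp (8 * z) := by rw [← Real.exp_nat_mul]; congr 1; ring
      _ ≤ Λ := hΛ1
  have hsmall' : (2 * n₀ + 1) * Lx ≤ Λ := by
    refine le_trans ?_ hsmall
    exact le_mul_of_one_le_right (by positivity) (by linarith)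
  -- The largest number of prime factors up to `x` that keeps the product below `exp Λ`; `n₀` of
  -- them are reserved for the second family and `t` remain.
  obtain ⟨s, hs⟩ : ∃ s : ℕ, s = ⌊Λ / Lx⌋₊ := ⟨_, rfl⟩
  have hs1 : s * Lx ≤ Λ := by
    rw [← le_div_iff₀ hLxpos, hs]
    exact Nat.floor_le (by positivity)
  have hs2 : Λ < (s + 1) * Lx := by
    rw [← div_lt_iff₀ hLxpos, hs]
    exact Nat.lt_floor_add_one _
  have hs3 : 2 * n₀ + 1 ≤ s := by
    rw [hs]
    refine Nat.le_floor ?_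
    rw [le_div_iff₀ hLxpos]
    push_cast
    exact hsmall'
  obtain ⟨t, rfl⟩ : ∃ t, s = t + n₀ := ⟨s - n₀, by omega⟩
  have ht : n₀ < t := by omega
  push_cast at hs1 hs2
  have ht0 : (0 : ℝ) < t := by exact_mod_cast (by omega : 0 < t)
  have hX : ((x ^ (t + n₀) : ℕ) : ℝ) ≤ Real.exp Λ := by
    have hxr : (0 : ℝ) < x := by exact_mod_cast hx
    push_cast
    rw [← Real.log_le_iff_le_exp (by positivity), Real.log_pow, ← hLx]
    push_cast
    exact hs1
  have hcount := choose_le_carmichaelCount_mul ν N M x n₀ t (Real.exp Λ) P P' hN hM hNM hP hgcd hdisj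
    hMN hPcard' ht hx hX
  have hr0 : (0 : ℝ) < P.card := by
    exact_mod_cast (by rw [hn₀]; positivity : 0 < n₀).trans_le hPcard
  have htΛ : t * Lx ≤ Λ := by
    refine le_trans ?_ hs1
    gcongr
    linarith
  have hlogt : Real.log t ≤ 16 * z := by
    have h1 : (t : ℝ) ≤ Λ := by
      refine le_trans ?_ htΛ
      exact le_mul_of_one_le_right ht0.le (by linarith)
    have h2 := Real.log_le_log ht0 (h1.trans hΛ2)
    rw [Real.log_exp] at h2
    linarith
  have hη1 : 1 / 2 ≤ 1 - η := by linarith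
  have htr : t ≤ P.card := by
    have : (t : ℝ) ≤ P.card := by
      rw [← Real.log_le_log_iff ht0 hr0]
      calc Real.log t ≤ 16 * z := hlogt
        _ ≤ Lx * (1 / 2) := by linarith
        _ ≤ Lx * (1 - η) := by gcongr
        _ ≤ _ := hlogP
    exact_mod_cast this
  have hcpos : 0 < (P.card).choose t := Nat.choose_pos htr
  have hCC : 0 < carmichaelCount ν (Real.exp Λ) := by
    rw [Nat.pos_iff_ne_zero]
    intro h0
    rw [h0, zero_mul] at hcount
    omega
  refine ⟨hCC, ?_⟩
  have hr1 : Real.log (P.card + 1 : ℕ) ≤ Lx := by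
    rw [hLx]
    refine Real.log_le_log (by positivity) ?_
    have : P.card ≤ x - 1 := by
      calc P.card ≤ (Finset.Icc 2 x).card := Finset.card_le_card fun p hp => by
            have := hP p (Finset.mem_union_left _ hp)
            exact Finset.mem_Icc.mpr ⟨this.1.two_le, this.2.1⟩
        _ = x - 1 := by simp
    exact_mod_cast (by omega : P.card + 1 ≤ x)
  have hlog1 : Real.log ((P.card).choose t) ≤
      Real.log (carmichaelCount ν (Real.exp Λ)) + n₀ * Real.log (P.card + 1 : ℕ) := by
    have hCCr : (0 : ℝ) < carmichaelCount ν (Real.exp Λ) := by exact_mod_cast hCC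
    rw [← Real.log_pow, ← Real.log_mul hCCr.ne' (by positivity)]
    exact Real.log_le_log (by exact_mod_cast hcpos) (by exact_mod_cast hcount)
  have hlog2 := mul_log_sub_log_le_log_choose (by omega) htr
  have e1 : t * (Lx * (1 - η)) ≤ t * Real.log P.card := by gcongr
  have e2 : n₀ * Real.log (P.card + 1 : ℕ) ≤ n₀ * Lx := by gcongr
  -- Here `log t ≤ 16 z`, while `Lx` is at least `z * ℓ`, so this loss is of relative size `16 / ℓ`.
  have e3 : t * Real.log t ≤ 16 * Λ / ℓ := by
    rw [le_div_iff₀ hℓ0]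
    calc t * Real.log t * ℓ ≤ t * (16 * z) * ℓ := by gcongr
      _ = t * (16 * (z * ℓ)) := by ring
      _ ≤ t * (16 * Lx) := by gcongr; linarith
      _ = 16 * (t * Lx) := by ring
      _ ≤ 16 * Λ := by gcongr
  -- One `n₀` pays for the reserved factors, one for the power of `P.card + 1`, and the `1` for
  -- rounding down; with `e3` this makes up the `17`.
  have e4 : (2 * n₀ + 1) * Lx ≤ Λ / ℓ := by rwa [le_div_iff₀ hℓ0]
  have e5 : Λ * (1 - η) ≤ (t + n₀ + 1) * Lx * (1 - η) := by gcongr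
  have e6 : (n₀ + 1) * Lx * (1 - η) ≤ (n₀ + 1) * Lx * 1 := by
    gcongr; linarith
  have e7 : Λ * (1 - (2 * Real.log ℓ + (C + 17)) / ℓ) = Λ * (1 - η) - 16 * Λ / ℓ - Λ / ℓ := by
    rw [hηdef]; field_simp; ring
  rw [e7]
  linarith

/-! ### Passage from `z` to `X` -/

open Filter in
/-- If `X ^ (1 - (2 + δ) * ρ X)` is eventually a lower bound for every `δ > 0`, then `δ` may be
replaced by a function tending to zero. -/
theorem exists_tendsto_zero_rpow_le {ρ F : ℝ → ℝ} (hρ : ∀ᶠ X in atTop, 0 < ρ X)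
    (h : ∀ δ > 0, ∀ᶠ X : ℝ in atTop, X ^ (1 - (2 + δ) * ρ X) ≤ F X) :
    ∃ ε : ℝ → ℝ, Tendsto ε atTop (nhds 0) ∧ ∀ᶠ X : ℝ in atTop, X ^ (1 - (2 + ε X) * ρ X) ≤ F X := by
  -- The second entry is the value of `ε` giving equality; truncation at zero only weakens the
  -- bound.
  refine ⟨fun X => max 0 ((1 - Real.log (F X) / Real.log X) / ρ X - 2), ?_, ?_⟩
  · rw [tendsto_order]
    refine ⟨fun a ha => Eventually.of_forall fun X => ha.trans_le (le_max_left _ _), fun a ha => ?_⟩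
    filter_upwards [h (a / 2) (by positivity), hρ, eventually_gt_atTop 1] with X hX hρX hX1
    have hX0 : 0 < X := by linarith
    refine max_lt ha ?_
    have h1 := Real.log_le_log (Real.rpow_pos_of_pos hX0 _) hX
    rw [Real.log_rpow hX0, ← le_div_iff₀ (Real.log_pos hX1)] at h1
    have h2 : (1 - Real.log (F X) / Real.log X) / ρ X ≤ 2 + a / 2 := by
      rw [div_le_iff₀ hρX]; linarith
    linarith
  · filter_upwards [h 1 one_pos, hρ, eventually_gt_atTop 1] with X hX hρX hX1
    have hX0 : 0 < X := by linarith
    have hF : 0 < F X := (Real.rpow_pos_of_pos hX0 _).trans_le hX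
    rw [Real.rpow_def_of_pos hX0, ← Real.le_log_iff_exp_le hF, mul_comm,
      ← le_div_iff₀ (Real.log_pos hX1)]
    have h1 := le_max_right 0 ((1 - Real.log (F X) / Real.log X) / ρ X - 2)
    have h2 : (1 - Real.log (F X) / Real.log X) / ρ X ≤
        2 + max 0 ((1 - Real.log (F X) / Real.log X) / ρ X - 2) := by linarith
    rw [div_le_iff₀ hρX] at h2
    linarith

-- For `s = log log X` the bounds put `log s` between `log z` and `log z + 3`, and the slack `δ log
-- log z` eventually absorbs this shift and the constant `C`.
open Filter in
theorem eventually_div_log_le_log_div_log (C δ : ℝ) (hC : 0 ≤ C) (hδ : 0 < δ) :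
    ∀ᶠ z : ℕ in atTop, ∀ s : ℝ, 8 * z ≤ s → s ≤ 8 * z + 8 →
      (2 * Real.log (Real.log z) + C) / Real.log z ≤
        (2 + δ) * (Real.log (Real.log s) / Real.log s) := by
  filter_upwards [tendsto_log_natCast_atTop.eventually_ge_atTop 1, eventually_ge_atTop 1,
    (Real.tendsto_log_atTop.comp tendsto_log_natCast_atTop).eventually_ge_atTop ((6 + 4 * C) / δ)]
    with z h1 h2 h3 s hs1 hs2
  obtain ⟨ℓ, hℓ⟩ : ∃ ℓ, ℓ = Real.log z := ⟨_, rfl⟩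
  simp only [Function.comp, ← hℓ] at h1 h3 ⊢
  have hz1 : (1 : ℝ) ≤ z := by exact_mod_cast h2
  have hz0 : (0 : ℝ) < z := by linarith
  have hup : Real.log s ≤ ℓ + 3 := by
    have : s ≤ 2 ^ 4 * z := by linarith
    refine (Real.log_le_log (by linarith) this).trans ?_
    rw [Real.log_mul (by norm_num) hz0.ne', Real.log_pow, ← hℓ]
    push_cast
    linarith [Real.log_two_lt_d9]
  have hlow : ℓ ≤ Real.log s := hℓ ▸ Real.log_le_log hz0 (by linarith)
  have hloglow : Real.log ℓ ≤ Real.log (Real.log s) := Real.log_le_log (by linarith) hlow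
  have hlogℓ0 : 0 ≤ Real.log ℓ := Real.log_nonneg h1
  have hlogℓ : Real.log ℓ ≤ ℓ := Real.log_le_self (by linarith)
  have h4 : 6 + 4 * C ≤ δ * Real.log ℓ := by
    rw [div_le_iff₀ hδ] at h3; linarith
  calc (2 * Real.log ℓ + C) / ℓ ≤ (2 + δ) * (Real.log ℓ / (ℓ + 3)) := by
        rw [← mul_div_assoc, div_le_div_iff₀ (by linarith) (by linarith)]
        have e1 : ℓ * (6 + 4 * C) ≤ ℓ * (δ * Real.log ℓ) := by gcongr
        have e2 : C * 1 ≤ C * ℓ := by gcongr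
        linarith
    _ ≤ (2 + δ) * (Real.log (Real.log s) / Real.log s) := by
        have : 0 < Real.log s := by linarith
        have : 0 ≤ Real.log (Real.log s) := by linarith
        gcongr

theorem mainTheorem1 (hHB : HeathBrownConjecture) (ν : ℕ) (hν : 0 < ν) (hν2 : Even ν) :
    ∃ ε : ℝ → ℝ, Filter.Tendsto ε Filter.atTop (nhds 0) ∧
      ∀ᶠ X : ℝ in Filter.atTop,
        X ^ (1 - (2 + ε X) * (Real.log (Real.log (Real.log (Real.log X))) /
          Real.log (Real.log (Real.log X)))) ≤ (carmichaelCount ν X : ℝ) := by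
  obtain ⟨A, hA, l₀, hHB⟩ := hHB
  have hlog := Real.tendsto_log_atTop
  refine exists_tendsto_zero_rpow_le ?_ fun δ hδ => ?_
  · filter_upwards [(hlog.comp (hlog.comp (hlog.comp hlog))).eventually_gt_atTop 0,
      (hlog.comp (hlog.comp hlog)).eventually_gt_atTop 0] with X h1 h2
    exact div_pos h1 h2
  obtain ⟨C, hC, hev⟩ := eventually_exists_prime_families (by linarith) hHB ν hν hν2
  -- The divisor `8` makes `log X` at least `exp 8 ^ z`. Since `exp 8 > 9`, this outgrows `9 ^ z`
  -- times any power of `z`, so the `n₀ = 9 ^ z` lost factors are negligible.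
  have hz : Filter.Tendsto (fun X : ℝ => ⌊Real.log (Real.log X) / 8⌋₊) Filter.atTop Filter.atTop :=
    tendsto_nat_floor_atTop.comp ((hlog.comp hlog).atTop_div_const (by norm_num))
  have h8 : (9 : ℝ) < Real.exp 8 := by
    have := Real.add_one_lt_exp (show (8 : ℝ) ≠ 0 by norm_num)
    linarith
  have hη : ∀ᶠ z : ℕ in Filter.atTop, (2 * Real.log (Real.log z) + C) / Real.log z ≤ 1 / 2 := by
    filter_upwards [eventually_log_log_le 8,
      tendsto_log_natCast_atTop.eventually_ge_atTop (4 * C + 1)] with z h1 h2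
    rw [div_le_iff₀ (by linarith)]
    linarith
  filter_upwards [hz.eventually hev, hz.eventually hη, hz.eventually_ge_atTop 1,
    hz.eventually (tendsto_log_natCast_atTop.eventually_ge_atTop 32),
    hz.eventually (eventually_pow_mul_pow_le 3 3 (by norm_num) h8),
    hz.eventually (eventually_div_log_le_log_div_log (C + 17) δ (by linarith) hδ),
    Filter.eventually_gt_atTop 1, hlog.eventually_gt_atTop 0, (hlog.comp hlog).eventually_ge_atTop 0]
    with X h1 h2 h3 h4 h5 h6 hX1 hX2 hX3
  simp only [Function.comp] at hX3
  obtain ⟨z, hzdef⟩ : ∃ z, z = ⌊Real.log (Real.log X) / 8⌋₊ := ⟨_, rfl⟩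
  rw [← hzdef] at h1 h2 h3 h4 h5 h6
  have hX0 : 0 < X := by linarith
  have hz1 : 8 * z ≤ Real.log (Real.log X) := by
    have := Nat.floor_le (show 0 ≤ Real.log (Real.log X) / 8 by positivity)
    rw [← hzdef] at this
    linarith
  have hz2 : Real.log (Real.log X) ≤ 8 * z + 8 := by
    have := Nat.lt_floor_add_one (Real.log (Real.log X) / 8)
    rw [← hzdef] at this
    linarith
  obtain ⟨N, M, x, P, P', hN, hM, hMN, hNM, hP, hgcd, hdisj, hPcard, hPcard', hx, hx1, hx2, hlogP⟩ := h1
  obtain ⟨hpos, hmain⟩ := le_log_carmichaelCount (Λ := Real.log X) hC hN hM hMN hNM hP hgcd hdisj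
    hPcard hPcard' hx hx1 hx2 hlogP h3 h4 h2 h5.le
    ((Real.le_log_iff_exp_le hX2).mp hz1) ((Real.log_le_iff_le_exp hX2).mp hz2)
  rw [Real.exp_log hX0] at hpos hmain
  rw [Real.rpow_def_of_pos hX0, ← Real.le_log_iff_exp_le (by exact_mod_cast hpos)]
  refine le_trans ?_ hmain
  gcongr
  exact h6 _ hz1 hz2
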